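/- Fix $t\in(0,1)$. For $d\ge 1$ and positive definite $A_1,A_2\in\mathcal B(\mathbb C^d)$ let $A_2\#_tA_1:=A_2^{1/2}\big(A_2^{-1/2}A_1A_2^{-1/2}\big)^tA_2^{1/2}$ be the $t$-weighted Kubo–Ando geometric mean, and, for $z\in(0,\infty)$, let $$G_{t,z}(A_1,A_2):=\Big(A_1^{\frac{t}{2z}}A_2^{\frac{1-t}{z}}A_1^{\frac{t}{2z}}\Big)^z,\qquad \widetilde G_{t,z}(A_1,A_2):=\Big(A_2^{\frac{1-t}{2z}}A_1^{\frac{t}{z}}A_2^{\frac{1-t}{2z}}\Big)^z,$$ $$\widehat G_{t,z}(A_1,A_2):=\Big(A_2^{\frac1z}\#_tA_1^{\frac1z}\Big)^z,\qquad \widehat G_{t,\infty}(A_1,A_2):=e^{t\log A_1+(1-t)\log A_2}.$$ Each of these is regarded as a $2$-variable positive operator function whose domain consists of all pairs of positive definite operators on $\mathbb C^d$, $d\ge1$. A $2$-variable positive operator function $G$ is called asymptotically individually AM bounded if for every $A=(A_1,A_2)$ in its domain there are positive measures $\mu_n$ on $\{1,2\}$, $n\ge 1$ (which may depend on $A$),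 such that, in the Löwner order, $$G(A_1,A_2)^{\otimes n}\le\int_{\{1,2\}}A_y^{\otimes n}\,d\mu_n(y)\quad(n\ge1)\qquad\text{and}\qquad\limsup_{n\to\infty}\frac1n\log\mu_n(\{1,2\})\le0.$$ (a) None of the following is asymptotically individually AM bounded: $G_{t,z}$ for any $z\in(0,\infty)$; $\widetilde G_{t,z}$ for any $z\in(0,\infty)$; $\widehat G_{t,z}$ for any $z\in(0,1)\cup(1,\infty]$. (b) Let $G'_t$ be any of $G_{t,z}$ with $z\in(0,\infty)$, $\widetilde G_{t,z}$ with $z\in(0,\infty)$, or $\widehat G_{t,z}$ with $z\in(1,\infty]$. Then there are positive definite operators $A_1,A_2\in\mathcal B(\mathbb C^2)$ such that $G'_t(A_1,A_2)\nleq A_2\#_tA_1$. -/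

import Mathlib

open Filter MeasureTheory
open scoped Matrix ComplexOrder MatrixOrder ENNReal

namespace OperatorMeans

/-- Operators on the Hilbert space `ℂ^d`, as matrices. The order `≤` on them is the Löwner order
(`A ≤ B` means that `B - A` is positive semi-definite). -/
abbrev Op (d : ℕ) := Matrix (Fin d) (Fin d) ℂ

/-- Matrix-valued integral `∫ F dμ`, taken entry by entry. -/
noncomputable def matIntegral {Y : Type*} [MeasurableSpace Y] {m : Type*} (μ : Measure Y)
    (F : Y → Matrix m m ℂ) : Matrix m m ℂ :=
  Matrix.of fun i j => ∫ y, F y i j ∂μ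

/-- The tensor power `A^{⊗n}`, in the product basis of `(ℂ^d)^{⊗n}`, which is indexed by
`Fin n → Fin d`. -/
def tensorPow {d : ℕ} (A : Op d) (n : ℕ) : Matrix (Fin n → Fin d) (Fin n → Fin d) ℂ :=
  Matrix.of fun i j => ∏ k, A (i k) (j k)

/-- A `Y`-variable positive operator function: it assigns a positive semi-definite operator on
`ℂ^d` to each family in its (non-empty) domain, which consists of measurable families of positive
semi-definite operators on `ℂ^d`, `d ≥ 1`, and it is covariant under unitaries.
Values of `toFun` outside the domain carry no meaning. -/
structure PosOpFun (Y : Type*) [MeasurableSpace Y] where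
  dom : ∀ d : ℕ, Set (Y → Op d)
  toFun : ∀ d : ℕ, (Y → Op d) → Op d
  dom_nonempty : ∃ d A, A ∈ dom d
  dom_pos : ∀ d, ∀ A ∈ dom d, 0 < d
  dom_measurable : ∀ d, ∀ A ∈ dom d, ∀ i j, Measurable fun y => A y i j
  dom_posSemidef : ∀ d, ∀ A ∈ dom d, ∀ y, (A y).PosSemidef
  posSemidef : ∀ d, ∀ A ∈ dom d, (toFun d A).PosSemidef
  dom_unitary : ∀ d, ∀ A ∈ dom d, ∀ V ∈ Matrix.unitaryGroup (Fin d) ℂ,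
    (fun y => V * A y * Vᴴ) ∈ dom d
  map_unitary : ∀ d, ∀ A ∈ dom d, ∀ V ∈ Matrix.unitaryGroup (Fin d) ℂ,
    toFun d (fun y => V * A y * Vᴴ) = V * toFun d A * Vᴴ

/-- Asymptotic individual arithmetic mean boundedness: for every `A` in the domain there are
positive measures `μ n` (which may depend on `A`), `n ≥ 1`, with
`G(A)^{⊗n} ≤ ∫ A_y^{⊗n} dμ_n(y)` and `limsup_n (1/n) log μ_n(Y) ≤ 0`. -/
def PosOpFun.AsympIndivAMBounded {Y : Type*} [MeasurableSpace Y] (G : PosOpFun Y) : Prop :=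
  ∀ d, ∀ A ∈ G.dom d, ∃ μ : ℕ → Measure Y,
    (∀ n, 1 ≤ n →
      (∀ i j, Integrable (fun y => tensorPow (A y) n i j) (μ n)) ∧
      tensorPow (G.toFun d A) n ≤ matIntegral (μ n) fun y => tensorPow (A y) n) ∧
    limsup (fun n : ℕ => ENNReal.log (μ n Set.univ) / (n : EReal)) atTop ≤ 0

/-- The real power `A^p` by functional calculus. -/
noncomputable def mpow {d : ℕ} (A : Op d) (p : ℝ) : Op d := cfc (fun x : ℝ => x ^ p) A

/-- The logarithm by functional calculus. -/
noncomputable def mlog {d : ℕ} (A : Op d) : Op d := cfc Real.log A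

/-- The exponential of a Hermitian matrix by functional calculus. -/
noncomputable def mexp {d : ℕ} (A : Op d) : Op d := cfc Real.exp A

/-- The `t`-weighted Kubo-Ando geometric mean `A₂ #_t A₁` of positive definite operators. -/
noncomputable def kuboAndo {d : ℕ} (t : ℝ) (A₂ A₁ : Op d) : Op d :=
  mpow A₂ (1 / 2) * mpow (mpow A₂ (-(1 / 2)) * A₁ * mpow A₂ (-(1 / 2))) t * mpow A₂ (1 / 2)

/-- `(A₁^{t/2z} A₂^{(1-t)/z} A₁^{t/2z})^z` -/
noncomputable def meanGFun {d : ℕ} (t z : ℝ) (A₁ A₂ : Op d) : Op d :=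
  mpow (mpow A₁ (t / (2 * z)) * mpow A₂ ((1 - t) / z) * mpow A₁ (t / (2 * z))) z

/-- `(A₂^{(1-t)/2z} A₁^{t/z} A₂^{(1-t)/2z})^z` -/
noncomputable def meanGTildeFun {d : ℕ} (t z : ℝ) (A₁ A₂ : Op d) : Op d :=
  mpow (mpow A₂ ((1 - t) / (2 * z)) * mpow A₁ (t / z) * mpow A₂ ((1 - t) / (2 * z))) z

/-- `(A₂^{1/z} #_t A₁^{1/z})^z` -/
noncomputable def meanGHatFun {d : ℕ} (t z : ℝ) (A₁ A₂ : Op d) : Op d :=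
  mpow (kuboAndo t (mpow A₂ (1 / z)) (mpow A₁ (1 / z))) z

/-- `exp (t log A₁ + (1-t) log A₂)`, the log-Euclidean geometric mean (the case `z = ∞`). -/
noncomputable def meanGHatTopFun {d : ℕ} (t : ℝ) (A₁ A₂ : Op d) : Op d :=
  mexp (t • mlog A₁ + (1 - t) • mlog A₂)

section Helpers

variable {d : ℕ}

theorem cfc_unitary_conj (f : ℝ → ℝ) (A : Op d) (hA : A.IsHermitian) {V : Op d}
    (hV : V ∈ Matrix.unitaryGroup (Fin d) ℂ) :
    cfc f (V * A * Vᴴ) = V * cfc f A * Vᴴ := by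
  have hA' : IsSelfAdjoint A := hA
  have h := StarAlgHomClass.map_cfc (S := ℂ) (Unitary.conjStarAlgAut ℂ (Op d) ⟨V, hV⟩) f A
    (Matrix.finite_real_spectrum.continuousOn _)
    (by
      have : Continuous fun x : Op d => V * x * Vᴴ := by fun_prop
      exact this) hA' (hA'.map _)
  exact h.symm

theorem mpow_posSemidef {A : Op d} (hA : A.PosSemidef) (p : ℝ) : (mpow A p).PosSemidef := by
  rw [← Matrix.nonneg_iff_posSemidef] at hA ⊢
  exact cfc_nonneg fun x hx => Real.rpow_nonneg (spectrum_nonneg_of_nonneg hA hx) p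

theorem sandwich_posSemidef {X B : Op d} (hX : X.PosSemidef) (hB : B.PosSemidef) :
    (X * B * X).PosSemidef := by
  have h := hB.mul_mul_conjTranspose_same X
  rwa [hX.isHermitian.eq] at h

theorem conj_mul_conj {V : Op d} (hV : V ∈ Matrix.unitaryGroup (Fin d) ℂ) (X Y : Op d) :
    (V * X * Vᴴ) * (V * Y * Vᴴ) = V * (X * Y) * Vᴴ := by
  have h : Vᴴ * V = 1 := Matrix.mem_unitaryGroup_iff'.1 hV
  calc (V * X * Vᴴ) * (V * Y * Vᴴ) = V * X * (Vᴴ * V) * Y * Vᴴ := by simp only [mul_assoc]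
    _ = V * (X * Y) * Vᴴ := by rw [h]; simp only [mul_assoc, one_mul]

theorem mpow_conj {A : Op d} (hA : A.PosSemidef) {V : Op d}
    (hV : V ∈ Matrix.unitaryGroup (Fin d) ℂ) (p : ℝ) :
    mpow (V * A * Vᴴ) p = V * mpow A p * Vᴴ :=
  cfc_unitary_conj _ A hA.isHermitian hV

theorem kuboAndo_posSemidef (t : ℝ) {A₂ A₁ : Op d} (h₂ : A₂.PosSemidef) (h₁ : A₁.PosSemidef) :
    (kuboAndo t A₂ A₁).PosSemidef :=
  sandwich_posSemidef (mpow_posSemidef h₂ _)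
    (mpow_posSemidef (sandwich_posSemidef (mpow_posSemidef h₂ _) h₁) _)

theorem kuboAndo_conj (t : ℝ) {A₂ A₁ : Op d} (h₂ : A₂.PosSemidef) (h₁ : A₁.PosSemidef)
    {V : Op d} (hV : V ∈ Matrix.unitaryGroup (Fin d) ℂ) :
    kuboAndo t (V * A₂ * Vᴴ) (V * A₁ * Vᴴ) = V * kuboAndo t A₂ A₁ * Vᴴ := by
  simp only [kuboAndo, mpow_conj h₂ hV, conj_mul_conj hV,
    mpow_conj (sandwich_posSemidef (mpow_posSemidef h₂ _) h₁) hV]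

end Helpers

/-- The positive operator function of two variables `(A₁, A₂) = (A 0, A 1)` given by a formula `F`
on the domain of all pairs of positive definite operators on `ℂ^d`, `d ≥ 1`. -/
def ofFormula (F : ∀ d : ℕ, Op d → Op d → Op d)
    (hpos : ∀ d (A₁ A₂ : Op d), A₁.PosDef → A₂.PosDef → (F d A₁ A₂).PosSemidef)
    (hconj : ∀ d (A₁ A₂ : Op d), A₁.PosDef → A₂.PosDef → ∀ V ∈ Matrix.unitaryGroup (Fin d) ℂ,
      F d (V * A₁ * Vᴴ) (V * A₂ * Vᴴ) = V * F d A₁ A₂ * Vᴴ) :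
    PosOpFun (Fin 2) where
  dom d := {A | 0 < d ∧ ∀ y, (A y).PosDef}
  toFun d A := F d (A 0) (A 1)
  dom_nonempty := ⟨1, fun _ => 1, one_pos, fun _ => Matrix.PosDef.one⟩
  dom_pos _ _ hA := hA.1
  dom_measurable _ _ _ _ _ := Measurable.of_discrete
  dom_posSemidef _ _ hA y := (hA.2 y).posSemidef
  posSemidef d A hA := hpos d _ _ (hA.2 0) (hA.2 1)
  dom_unitary d A hA V hV := by
    refine ⟨hA.1, fun y => (hA.2 y).mul_mul_conjTranspose_same ?_⟩
    have h : V * Vᴴ = 1 := Matrix.mem_unitaryGroup_iff.1 hV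
    intro x y hxy
    have hx := congrArg (fun w => Matrix.vecMul w Vᴴ) hxy
    simpa [Matrix.vecMul_vecMul, h] using hx
  map_unitary d A hA V hV := hconj d _ _ (hA.2 0) (hA.2 1) V hV

/-- The mean `G_{t,z}`. -/
noncomputable def meanG (t z : ℝ) : PosOpFun (Fin 2) :=
  ofFormula (fun _ A₁ A₂ => meanGFun t z A₁ A₂)
    (fun _ _ _ h₁ h₂ => mpow_posSemidef (sandwich_posSemidef (mpow_posSemidef h₁.posSemidef _)
      (mpow_posSemidef h₂.posSemidef _)) _)
    (fun _ _ _ h₁ h₂ V hV => by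
      simp only [meanGFun, mpow_conj h₁.posSemidef hV, mpow_conj h₂.posSemidef hV,
        conj_mul_conj hV, mpow_conj (sandwich_posSemidef (mpow_posSemidef h₁.posSemidef _)
          (mpow_posSemidef h₂.posSemidef _)) hV])

/-- The mean `G̃_{t,z}`. -/
noncomputable def meanGTilde (t z : ℝ) : PosOpFun (Fin 2) :=
  ofFormula (fun _ A₁ A₂ => meanGTildeFun t z A₁ A₂)
    (fun _ _ _ h₁ h₂ => mpow_posSemidef (sandwich_posSemidef (mpow_posSemidef h₂.posSemidef _)
      (mpow_posSemidef h₁.posSemidef _)) _)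
    (fun _ _ _ h₁ h₂ V hV => by
      simp only [meanGTildeFun, mpow_conj h₁.posSemidef hV, mpow_conj h₂.posSemidef hV,
        conj_mul_conj hV, mpow_conj (sandwich_posSemidef (mpow_posSemidef h₂.posSemidef _)
          (mpow_posSemidef h₁.posSemidef _)) hV])

/-- The mean `Ĝ_{t,z}`, `z` finite. -/
noncomputable def meanGHat (t z : ℝ) : PosOpFun (Fin 2) :=
  ofFormula (fun _ A₁ A₂ => meanGHatFun t z A₁ A₂)
    (fun _ _ _ h₁ h₂ => mpow_posSemidef (kuboAndo_posSemidef t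
      (mpow_posSemidef h₂.posSemidef _) (mpow_posSemidef h₁.posSemidef _)) _)
    (fun _ _ _ h₁ h₂ V hV => by
      simp only [meanGHatFun, mpow_conj h₁.posSemidef hV, mpow_conj h₂.posSemidef hV,
        kuboAndo_conj t (mpow_posSemidef h₂.posSemidef _) (mpow_posSemidef h₁.posSemidef _) hV,
        mpow_conj (kuboAndo_posSemidef t (mpow_posSemidef h₂.posSemidef _)
          (mpow_posSemidef h₁.posSemidef _)) hV])

/-- The mean `Ĝ_{t,∞}`. -/
noncomputable def meanGHatTop (t : ℝ) : PosOpFun (Fin 2) :=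
  ofFormula (fun _ A₁ A₂ => meanGHatTopFun t A₁ A₂)
    (fun _ _ _ _ _ => by
      rw [← Matrix.nonneg_iff_posSemidef]
      exact cfc_nonneg fun x _ => (Real.exp_pos x).le)
    (fun _ A₁ A₂ h₁ h₂ V hV => by
      have hs : (t • mlog A₁ + (1 - t) • mlog A₂).IsHermitian := by
        have e₁ : IsSelfAdjoint (mlog A₁) := cfc_predicate _ _
        have e₂ : IsSelfAdjoint (mlog A₂) := cfc_predicate _ _
        exact ((IsSelfAdjoint.all t).smul e₁).add ((IsSelfAdjoint.all (1 - t)).smul e₂)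
      simp only [meanGHatTopFun, mexp]
      rw [← cfc_unitary_conj _ _ hs hV]
      simp only [mlog, cfc_unitary_conj _ _ h₁.isHermitian hV,
        cfc_unitary_conj _ _ h₂.isHermitian hV, mul_add, add_mul, mul_smul_comm, smul_mul_assoc])

end OperatorMeans

/-! The proof has two independent halves.

Upper bound (`le_kuboAndo_of_asympIndivAMBounded`): a mean `G` that is asymptotically individually
AM bounded and `t`-homogeneous in `A₁` lies below `A₂ #_t A₁`. A congruence turns `A₂` into `1`,
`A₁` into `diag b` and the Kubo-Ando mean into `diag (b^t)`, and it acts on tensor powers as well.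
Homogeneity allows the AM bound to be applied to `(c A₁, A₂)` for every `c > 0`, giving `c^{tn}
X^{⊗n} ≤ e^{εn} (c^n (diag b)^{⊗n} + 1)` for large `n`, with `X` the transformed mean. On the
coordinates where `∏ b ≈ e^{ns}`, the choice `c = e^{-s}` balances the two terms and leaves `(∏
b)^t` up to `e^{O(εn)}`. Finitely many `s` suffice for all `n`, so gluing the blocks costs only a
constant factor. Testing on `ψ^{⊗n}`, taking `n`-th roots and letting `ε → 0` gives the claim
(`qform_le_sum_rpow`).

Failure of that bound: take `A₁ = exp(a σ_z)` and `A₂ = exp(b σ_x)`. All the means then have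
determinant 1, so `G ≤ K` would force `G = K` (`eq_of_le_of_det_eq`). Each `G` is a function of an
explicit matrix `c I + x σ_z + y σ_x`, so equality would force the vector `(x, y)` to be parallel to
that of the Kubo-Ando mean (`not_le_kuboAndo_of_eq_cfc`). The slope of the latter changes like
`e^{2ta}` as `a` grows, a rate that none of the other means matches. Hence (b), and with the upper
bound (a). -/

namespace OperatorMeans

/-! ### Functional calculus of positive definite matrices, congruence, determinants -/

section Spectral

variable {d : ℕ}

theorem exists_spectral_form {A : Op d} (hA : A.IsHermitian) :
    ∃ U ∈ Matrix.unitaryGroup (Fin d) ℂ, ∃ l : Fin d → ℝ,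
      (∀ i, l i ∈ spectrum ℝ A) ∧
      ∀ f : ℝ → ℝ, cfc f A = U * Matrix.diagonal (fun i => (f (l i) : ℂ)) * Uᴴ := by
  refine ⟨hA.eigenvectorUnitary, hA.eigenvectorUnitary.2, hA.eigenvalues,
    hA.eigenvalues_mem_spectrum_real, fun f => ?_⟩
  rw [hA.cfc_eq]
  rfl

theorem cfc_smul_of_forall {A : Op d} (hA : A.IsHermitian) (c : ℝ) (f : ℝ → ℝ) :
    cfc f (c • A) = cfc (fun x => f (c * x)) A := by
  have hA' : IsSelfAdjoint A := hA
  exact (cfc_comp_smul c f A ((A.finite_real_spectrum.image _).continuousOn _) hA').symm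

theorem pos_of_mem_spectrum {A : Op d} (hA : A.PosDef) {x : ℝ} (hx : x ∈ spectrum ℝ A) : 0 < x := by
  have hA' := Matrix.isStrictlyPositive_iff_posDef.2 hA
  exact hA'.spectrum_pos hx

theorem cfc_posDef {A : Op d} (hA : A.IsHermitian) {f : ℝ → ℝ} (hf : ∀ x ∈ spectrum ℝ A, 0 < f x) :
    (cfc f A).PosDef := by
  have hA' : IsSelfAdjoint A := hA
  rw [← Matrix.isStrictlyPositive_iff_posDef]
  exact (cfc_isStrictlyPositive_iff f A (A.finite_real_spectrum.continuousOn _) hA').2 hf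

theorem mpow_posDef {A : Op d} (hA : A.PosDef) (p : ℝ) : (mpow A p).PosDef :=
  cfc_posDef hA.isHermitian fun _ hx => Real.rpow_pos_of_pos (pos_of_mem_spectrum hA hx) p

theorem mpow_smul {A : Op d} (hA : A.PosDef) {c : ℝ} (hc : 0 < c) (p : ℝ) :
    mpow (c • A) p = c ^ p • mpow A p := by
  have hA' : IsSelfAdjoint A := hA.isHermitian
  rw [mpow, cfc_smul_of_forall hA.isHermitian, mpow,
    ← cfc_const_mul (c ^ p) _ A (A.finite_real_spectrum.continuousOn _)]
  exact cfc_congr fun x hx => Real.mul_rpow hc.le (pos_of_mem_spectrum hA hx).le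

theorem mpow_mul_mpow {A : Op d} (hA : A.PosDef) (p q : ℝ) :
    mpow A p * mpow A q = mpow A (p + q) := by
  rw [mpow, mpow, mpow, ← cfc_mul _ _ A (A.finite_real_spectrum.continuousOn _)
    (A.finite_real_spectrum.continuousOn _)]
  exact cfc_congr fun x hx => (Real.rpow_add (pos_of_mem_spectrum hA hx) p q).symm

theorem mpow_zero {A : Op d} (hA : A.PosDef) : mpow A 0 = 1 := by
  have hA' : IsSelfAdjoint A := hA.isHermitian
  simp only [mpow, Real.rpow_zero]
  exact cfc_const_one ℝ A

theorem mpow_one {A : Op d} (hA : A.PosDef) : mpow A 1 = A := by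
  have hA' : IsSelfAdjoint A := hA.isHermitian
  simp only [mpow, Real.rpow_one]
  exact cfc_id' ℝ A

theorem mlog_smul {A : Op d} (hA : A.PosDef) {c : ℝ} (hc : 0 < c) :
    mlog (c • A) = Real.log c • 1 + mlog A := by
  have hA' : IsSelfAdjoint A := hA.isHermitian
  rw [mlog, cfc_smul_of_forall hA.isHermitian, mlog]
  have h := cfc_add A (fun _ : ℝ => Real.log c) Real.log
    (A.finite_real_spectrum.continuousOn _) (A.finite_real_spectrum.continuousOn _)
  rw [cfc_const _ A, Algebra.algebraMap_eq_smul_one] at h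
  rw [← h]
  exact cfc_congr fun x hx => Real.log_mul hc.ne' (pos_of_mem_spectrum hA hx).ne'

theorem mexp_smul_one_add {A : Op d} (hA : A.IsHermitian) (c : ℝ) :
    mexp (c • 1 + A) = Real.exp c • mexp A := by
  have hA' : IsSelfAdjoint A := hA
  have h : c • (1 : Op d) + A = cfc (fun x : ℝ => c + x) A := by
    rw [cfc_const_add c _ A, cfc_id' ℝ A, Algebra.algebraMap_eq_smul_one]
  rw [h, mexp, ← cfc_comp' Real.exp _ A ((A.finite_real_spectrum.image _).continuousOn _)
    (A.finite_real_spectrum.continuousOn _), mexp,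
    ← cfc_const_mul _ _ A (A.finite_real_spectrum.continuousOn _)]
  exact cfc_congr fun x _ => Real.exp_add c x

theorem sandwich_posDef {X B : Op d} (hX : X.PosDef) (hB : B.PosDef) : (X * B * X).PosDef := by
  have h := (Matrix.IsUnit.posDef_star_left_conjugate_iff hX.isUnit (x := B)).2 hB
  rwa [Matrix.star_eq_conjTranspose, hX.isHermitian.eq] at h

theorem kuboAndo_posDef (t : ℝ) {A₂ A₁ : Op d} (h₂ : A₂.PosDef) (h₁ : A₁.PosDef) :
    (kuboAndo t A₂ A₁).PosDef :=
  sandwich_posDef (mpow_posDef h₂ _)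
    (mpow_posDef (sandwich_posDef (mpow_posDef h₂ _) h₁) _)

theorem det_mpow {A : Op d} (hA : A.PosDef) (hdet : A.det = 1) (p : ℝ) : (mpow A p).det = 1 := by
  have hA' : IsSelfAdjoint A := hA.isHermitian
  obtain ⟨U, hU, l, hl, hf⟩ := exists_spectral_form hA.isHermitian
  have hdetf : ∀ f : ℝ → ℝ, (cfc f A).det = ((∏ i, f (l i) : ℝ) : ℂ) := by
    intro f
    have h : U.det * Uᴴ.det = 1 := by
      rw [← Matrix.det_mul, ← Matrix.star_eq_conjTranspose, Matrix.mem_unitaryGroup_iff.1 hU,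
        Matrix.det_one]
    rw [hf, Matrix.det_mul, Matrix.det_mul, Matrix.det_diagonal, mul_right_comm, h, one_mul]
    push_cast
    rfl
  have h1 := hdetf fun x => x
  rw [cfc_id' ℝ A hA', hdet] at h1
  have h2 : ∏ i, l i = 1 := by exact_mod_cast h1.symm
  rw [mpow, hdetf, Real.finsetProd_rpow _ _ fun i _ => (pos_of_mem_spectrum hA (hl i)).le,
    h2, Real.one_rpow, Complex.ofReal_one]

/-- The congruence is `S = A₂^{-1/2} U`, where `U` diagonalizes `A₂^{-1/2} A₁ A₂^{-1/2}`. The same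
`U` diagonalizes the `t`-th power inside the Kubo-Ando mean, whose outer factors `A₂^{1/2}` are
cancelled by `S`. -/
theorem exists_simultaneous_diag (t : ℝ) {A₁ A₂ : Op d} (h₁ : A₁.PosDef) (h₂ : A₂.PosDef) :
    ∃ S : Op d, IsUnit S ∧ ∃ b : Fin d → ℝ, (∀ i, 0 < b i) ∧ Sᴴ * A₂ * S = 1 ∧
      Sᴴ * A₁ * S = Matrix.diagonal (fun i => (b i : ℂ)) ∧
      Sᴴ * kuboAndo t A₂ A₁ * S = Matrix.diagonal (fun i => ((b i ^ t : ℝ) : ℂ)) := by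
  set T := mpow A₂ (-(1 / 2)) with hT
  have hTp : T.PosDef := mpow_posDef h₂ _
  have hB : (T * A₁ * T).PosDef := sandwich_posDef hTp h₁
  have hB' : IsSelfAdjoint (T * A₁ * T) := hB.isHermitian
  obtain ⟨U, hU, l, hl, hf⟩ := exists_spectral_form hB.isHermitian
  have hUU : Uᴴ * U = 1 := Matrix.mem_unitaryGroup_iff'.1 hU
  have hUU' : U * Uᴴ = 1 := Matrix.mem_unitaryGroup_iff.1 hU
  have hTT : T * mpow A₂ (1 / 2) = 1 := by
    rw [hT, mpow_mul_mpow h₂, neg_add_cancel, mpow_zero h₂]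
  have hTT' : mpow A₂ (1 / 2) * T = 1 := by
    rw [hT, mpow_mul_mpow h₂, add_neg_cancel, mpow_zero h₂]
  have hA₂ : A₂ = mpow A₂ (1 / 2) * mpow A₂ (1 / 2) := by
    rw [mpow_mul_mpow h₂, add_halves, mpow_one h₂]
  have hconj : ∀ M : Op d, (T * U)ᴴ * M * (T * U) = Uᴴ * (T * M * T) * U := by
    intro M
    rw [Matrix.conjTranspose_mul, hTp.isHermitian.eq]
    simp only [mul_assoc]
  have hdiag : ∀ f : ℝ → ℝ, Uᴴ * cfc f (T * A₁ * T) * U =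
      Matrix.diagonal (fun i => (f (l i) : ℂ)) := by
    intro f
    rw [hf]
    calc _ = (Uᴴ * U) * Matrix.diagonal (fun i => (f (l i) : ℂ)) * (Uᴴ * U) := by
          simp only [mul_assoc]
      _ = _ := by rw [hUU, one_mul, mul_one]
  refine ⟨T * U, hTp.isUnit.mul ⟨⟨U, Uᴴ, hUU', hUU⟩, rfl⟩, l,
    fun i => pos_of_mem_spectrum hB (hl i), ?_, ?_, ?_⟩
  · rw [hconj, hA₂, ← mul_assoc T, hTT, one_mul, hTT', mul_one, hUU]
  · rw [hconj, ← hdiag fun x => x, cfc_id' ℝ _ hB']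
  · have : T * kuboAndo t A₂ A₁ * T = cfc (fun x : ℝ => x ^ t) (T * A₁ * T) := by
      calc T * kuboAndo t A₂ A₁ * T
          = (T * mpow A₂ (1 / 2)) * mpow (T * A₁ * T) t * (mpow A₂ (1 / 2) * T) := by
            simp only [kuboAndo, mul_assoc, hT]
        _ = _ := by rw [hTT, hTT', one_mul, mul_one, mpow]
    rw [hconj, this, hdiag]

/-- After a congruence taking `K` to `1` and `G` to `diag b`, the order gives `b i ≤ 1` and the
determinants give `∏ b = 1`, so every `b i` is 1. -/
theorem eq_of_le_of_det_eq {G K : Op d} (hG : G.PosDef) (hK : K.PosDef) (hle : G ≤ K)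
    (hdet : G.det = K.det) : G = K := by
  -- The weight 1 is a dummy: the Kubo-Ando component is discarded.
  obtain ⟨S, hS, b, hb, hK1, hG1, -⟩ := exists_simultaneous_diag 1 hG hK
  have hb1 : ∀ i, b i ≤ 1 := by
    have h : (Sᴴ * (K - G) * S).PosSemidef :=
      (Matrix.le_iff.1 hle).conjTranspose_mul_mul_same S
    rw [mul_sub, sub_mul, hK1, hG1, ← Matrix.diagonal_one, Matrix.diagonal_sub,
      Matrix.posSemidef_diagonal_iff] at h
    intro i
    have := h i
    rw [sub_nonneg] at this
    exact_mod_cast this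
  have hprod : ∏ i, b i = 1 := by
    have h1 : (Sᴴ * G * S).det = (Sᴴ * K * S).det := by simp only [Matrix.det_mul, hdet]
    rw [hK1, hG1, Matrix.det_diagonal, Matrix.det_one] at h1
    exact_mod_cast h1
  have hb2 : ∀ i, b i = 1 := by
    intro i
    refine le_antisymm (hb1 i) ?_
    calc 1 = ∏ j, b j := hprod.symm
      _ = b i * ∏ j ∈ Finset.univ.erase i, b j :=
        (Finset.mul_prod_erase _ _ (Finset.mem_univ i)).symm
      _ ≤ b i * 1 := by
        gcongr
        · exact (hb i).le
        · exact Finset.prod_le_one (fun j _ => (hb j).le) fun j _ => hb1 j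
      _ = b i := mul_one _
  have h : Sᴴ * G * S = Sᴴ * K * S := by
    rw [hG1, hK1]
    simp [hb2]
  have hS' : IsUnit Sᴴ := by
    rw [← Matrix.star_eq_conjTranspose]
    exact hS.star
  exact hS'.mul_left_cancel (by simpa [mul_assoc] using hS.mul_right_cancel h)

end Spectral

/-! ### Quadratic forms of complex matrices -/

section QuadraticForm

variable {m : Type*} [Fintype m]

/-- The real quadratic form `Re ⟨v, M v⟩` of a matrix. -/
def qform (M : Matrix m m ℂ) (v : m → ℂ) : ℝ := (star v ⬝ᵥ M *ᵥ v).re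

theorem qform_nonneg {M : Matrix m m ℂ} (hM : M.PosSemidef) (v : m → ℂ) : 0 ≤ qform M v :=
  (Complex.le_def.1 (hM.dotProduct_mulVec_nonneg v)).1

theorem qform_add (M N : Matrix m m ℂ) (v : m → ℂ) :
    qform (M + N) v = qform M v + qform N v := by
  simp [qform, Matrix.add_mulVec, dotProduct_add]

theorem qform_sub (M N : Matrix m m ℂ) (v : m → ℂ) :
    qform (M - N) v = qform M v - qform N v := by
  simp [qform, Matrix.sub_mulVec, dotProduct_sub]

theorem qform_smul (r : ℝ) (M : Matrix m m ℂ) (v : m → ℂ) :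
    qform (r • M) v = r * qform M v := by
  simp [qform, Matrix.smul_mulVec, dotProduct_smul]

theorem qform_le_of_le {M N : Matrix m m ℂ} (h : M ≤ N) (v : m → ℂ) : qform M v ≤ qform N v := by
  have := qform_nonneg (Matrix.le_iff.1 h) v
  rwa [qform_sub, sub_nonneg] at this

theorem le_of_qform_le {M N : Matrix m m ℂ} (hM : M.IsHermitian) (hN : N.IsHermitian)
    (h : ∀ v, qform M v ≤ qform N v) : M ≤ N := by
  refine Matrix.le_iff.2 (.of_dotProduct_mulVec_nonneg (hN.sub hM) fun v => ?_)
  rw [Complex.le_def]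
  refine ⟨?_, ((hN.sub hM).im_star_dotProduct_mulVec_self v).symm⟩
  have := h v
  rw [← sub_nonneg, ← qform_sub] at this
  exact this

theorem qform_conj (S M : Matrix m m ℂ) (v : m → ℂ) :
    qform (Sᴴ * M * S) v = qform M (S *ᵥ v) := by
  rw [qform, qform, Matrix.star_mulVec, ← Matrix.dotProduct_mulVec, Matrix.mulVec_mulVec,
    Matrix.mulVec_mulVec, mul_assoc]

theorem qform_diagonal [DecidableEq m] (a : m → ℝ) (v : m → ℂ) :
    qform (Matrix.diagonal fun i => (a i : ℂ)) v = ∑ i, a i * ‖v i‖ ^ 2 := by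
  simp only [qform, dotProduct, Matrix.mulVec_diagonal, Complex.re_sum]
  refine Finset.sum_congr rfl fun i _ => ?_
  rw [Pi.star_apply, mul_left_comm, Complex.star_def, ← Complex.normSq_eq_conj_mul_self,
    ← Complex.ofReal_mul, Complex.ofReal_re, Complex.normSq_eq_norm_sq]

theorem qform_one [DecidableEq m] (v : m → ℂ) : qform (1 : Matrix m m ℂ) v = ∑ i, ‖v i‖ ^ 2 := by
  have := qform_diagonal (fun _ : m => (1 : ℝ)) v
  simpa using this

theorem exists_qform_eq_sum_norm_sq [DecidableEq m] {M : Matrix m m ℂ} (hM : M.PosSemidef) :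
    ∃ Y : Matrix m m ℂ, ∀ v, qform M v = ∑ i, ‖(Y *ᵥ v) i‖ ^ 2 := by
  obtain ⟨Y, hY⟩ := CStarAlgebra.nonneg_iff_eq_star_mul_self.1 (Matrix.nonneg_iff_posSemidef.2 hM)
  refine ⟨Y, fun v => ?_⟩
  rw [hY, Matrix.star_eq_conjTranspose, ← mul_one Yᴴ, qform_conj, qform_one]

/-- Cauchy-Schwarz for `M = Y* Y`. This plays the role of the pinching inequality: cutting a vector
into `|s|` pieces loses only the factor `|s|`. -/
theorem qform_sum_le [DecidableEq m] {M : Matrix m m ℂ} (hM : M.PosSemidef) {ι : Type*}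
    (s : Finset ι) (v : ι → m → ℂ) :
    qform M (∑ j ∈ s, v j) ≤ s.card * ∑ j ∈ s, qform M (v j) := by
  obtain ⟨Y, hY⟩ := exists_qform_eq_sum_norm_sq hM
  simp only [hY]
  rw [Finset.sum_comm, Finset.mul_sum]
  refine Finset.sum_le_sum fun i _ => ?_
  rw [Matrix.mulVec_sum, Finset.sum_apply]
  calc ‖∑ j ∈ s, (Y *ᵥ v j) i‖ ^ 2 ≤ (∑ j ∈ s, ‖(Y *ᵥ v j) i‖) ^ 2 := by
        gcongr
        exact norm_sum_le _ _
    _ ≤ _ := sq_sum_le_card_mul_sum_sq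

end QuadraticForm

/-! ### Tensor powers and the asymptotic AM bound as a scalar inequality -/

section TensorPower

variable {d : ℕ}

theorem tensorPow_mul (A B : Op d) (n : ℕ) :
    tensorPow (A * B) n = tensorPow A n * tensorPow B n := by
  ext i j
  simp only [tensorPow, Matrix.mul_apply, Matrix.of_apply, Finset.prod_univ_sum,
    Fintype.piFinset_univ, Finset.prod_mul_distrib]

theorem tensorPow_conjTranspose (A : Op d) (n : ℕ) : tensorPow Aᴴ n = (tensorPow A n)ᴴ := by
  ext i j
  simp [tensorPow, Matrix.conjTranspose_apply]

theorem tensorPow_diagonal (b : Fin d → ℂ) (n : ℕ) :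
    tensorPow (Matrix.diagonal b) n = Matrix.diagonal fun i => ∏ k, b (i k) := by
  ext i j
  simp only [tensorPow, Matrix.of_apply, Matrix.diagonal_apply]
  split_ifs with h
  · subst h
    simp
  · obtain ⟨k, hk⟩ := Function.ne_iff.1 h
    exact Finset.prod_eq_zero (Finset.mem_univ k) (if_neg hk)

theorem tensorPow_one (n : ℕ) : tensorPow (1 : Op d) n = 1 := by
  rw [← Matrix.diagonal_one, tensorPow_diagonal]
  simp

theorem tensorPow_smul (c : ℝ) (A : Op d) (n : ℕ) : tensorPow (c • A) n = c ^ n • tensorPow A n := by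
  ext i j
  simp [tensorPow, Finset.prod_mul_distrib]

theorem tensorPow_posSemidef {A : Op d} (hA : A.PosSemidef) (n : ℕ) :
    (tensorPow A n).PosSemidef := by
  obtain ⟨Y, hY⟩ := CStarAlgebra.nonneg_iff_eq_star_mul_self.1 (Matrix.nonneg_iff_posSemidef.2 hA)
  rw [hY, Matrix.star_eq_conjTranspose, tensorPow_mul, tensorPow_conjTranspose]
  exact Matrix.posSemidef_conjTranspose_mul_self _

/-- Product vectors make the form multiplicative, which is what permits taking `n`-th roots at the
end. -/
theorem qform_tensorPow {A : Op d} (hA : A.PosSemidef) (ψ : Fin d → ℂ) (n : ℕ) :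
    qform (tensorPow A n) (fun i => ∏ k, ψ (i k)) = qform A ψ ^ n := by
  have h1 : tensorPow A n *ᵥ (fun i => ∏ k, ψ (i k)) = fun i => ∏ k, (A *ᵥ ψ) (i k) := by
    ext i
    simp only [tensorPow, Matrix.mulVec, dotProduct, Matrix.of_apply, Finset.prod_univ_sum,
      Fintype.piFinset_univ, Finset.prod_mul_distrib]
  have h2 : star (fun i : Fin n → Fin d => ∏ k, ψ (i k)) ⬝ᵥ (fun i => ∏ k, (A *ᵥ ψ) (i k)) =
      (star ψ ⬝ᵥ A *ᵥ ψ) ^ n := by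
    have := Finset.prod_univ_sum (fun _ : Fin n => (Finset.univ : Finset (Fin d)))
      (fun _ x => star (ψ x) * (A *ᵥ ψ) x)
    rw [Finset.prod_const, Finset.card_univ, Fintype.card_fin, Fintype.piFinset_univ] at this
    simp only [dotProduct, Pi.star_apply, star_prod]
    rw [this]
    simp only [Finset.prod_mul_distrib]
  have h3 : star ψ ⬝ᵥ A *ᵥ ψ = (qform A ψ : ℂ) :=
    Complex.ext rfl (Complex.le_def.1 (hA.dotProduct_mulVec_nonneg ψ)).2.symm
  rw [qform, h1, h2, h3, ← Complex.ofReal_pow, Complex.ofReal_re]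

theorem qform_tensorPow_conj (S A : Op d) (n : ℕ) (v : (Fin n → Fin d) → ℂ) :
    qform (tensorPow (Sᴴ * A * S) n) v = qform (tensorPow A n) (tensorPow S n *ᵥ v) := by
  rw [tensorPow_mul, tensorPow_mul, tensorPow_conjTranspose, qform_conj]

theorem matIntegral_fin_two {m : Type*} {μ : Measure (Fin 2)} {F : Fin 2 → Matrix m m ℂ}
    (hF : ∀ i j, Integrable (fun y => F y i j) μ) :
    matIntegral μ F = μ.real {0} • F 0 + μ.real {1} • F 1 := by
  ext i j
  simp [matIntegral, integral_fintype (hF i j)]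

theorem eventually_measure_le_exp {Y : Type*} [MeasurableSpace Y] {μ : ℕ → Measure Y}
    (hμ : limsup (fun n : ℕ => ENNReal.log (μ n Set.univ) / (n : EReal)) atTop ≤ 0)
    {ε : ℝ} (hε : 0 < ε) :
    ∀ᶠ n in atTop, μ n Set.univ ≤ ENNReal.ofReal (Real.exp (ε * n)) := by
  have h : limsup (fun n : ℕ => ENNReal.log (μ n Set.univ) / (n : EReal)) atTop < (ε : EReal) :=
    hμ.trans_lt (EReal.coe_pos.2 hε)
  filter_upwards [eventually_lt_of_limsup_lt h, eventually_ge_atTop 1] with n hn hn1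
  rw [EReal.div_lt_iff (by exact_mod_cast hn1) (EReal.natCast_ne_top n)] at hn
  rw [← ENNReal.log_le_log_iff, ENNReal.log_ofReal_of_pos (Real.exp_pos _), Real.log_exp]
  exact_mod_cast hn.le

/-- Each of the two weights is at most the total mass, which is eventually below `e^{εn}`; the
measures disappear from the argument here. The threshold for `n` does not depend on `v`. -/
theorem eventually_qform_tensorPow_le {A : Fin 2 → Op d} (hA : ∀ y, (A y).PosSemidef) {X : Op d}
    {μ : ℕ → Measure (Fin 2)}
    (h : ∀ n, 1 ≤ n → (∀ i j, Integrable (fun y => tensorPow (A y) n i j) (μ n)) ∧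
      tensorPow X n ≤ matIntegral (μ n) fun y => tensorPow (A y) n)
    (hμ : limsup (fun n : ℕ => ENNReal.log (μ n Set.univ) / (n : EReal)) atTop ≤ 0)
    {ε : ℝ} (hε : 0 < ε) :
    ∀ᶠ n : ℕ in atTop, ∀ v, qform (tensorPow X n) v ≤
      Real.exp (ε * n) * (qform (tensorPow (A 0) n) v + qform (tensorPow (A 1) n) v) := by
  filter_upwards [eventually_measure_le_exp hμ hε, eventually_ge_atTop 1] with n hn hn1 v
  obtain ⟨hint, hle⟩ := h n hn1
  rw [matIntegral_fin_two hint] at hle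
  have hy : ∀ y : Fin 2, (μ n).real {y} ≤ Real.exp (ε * n) := fun y =>
    ENNReal.toReal_le_of_le_ofReal (Real.exp_pos _).le
      ((measure_mono (Set.subset_univ _)).trans hn)
  refine (qform_le_of_le hle v).trans ?_
  rw [qform_add, qform_smul, qform_smul, mul_add]
  exact add_le_add
    (mul_le_mul_of_nonneg_right (hy 0) (qform_nonneg (tensorPow_posSemidef (hA 0) n) v))
    (mul_le_mul_of_nonneg_right (hy 1) (qform_nonneg (tensorPow_posSemidef (hA 1) n) v))

end TensorPower

/-! ### The Kubo-Ando mean as an upper bound -/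

section KuboAndoBound

variable {d : ℕ}

theorem le_of_eventually_pow_le_const_mul_pow {a r C : ℝ} (hr : 0 ≤ r)
    (h : ∀ᶠ n : ℕ in atTop, a ^ n ≤ C * r ^ n) : a ≤ r := by
  by_contra! hra
  have ha : 0 < a := hr.trans_lt hra
  have hlim : Tendsto (fun n : ℕ => C * (r / a) ^ n) atTop (nhds (C * 0)) :=
    (tendsto_pow_atTop_nhds_zero_of_lt_one (div_nonneg hr ha.le)
      ((div_lt_one ha).2 hra)).const_mul C
  rw [mul_zero] at hlim
  obtain ⟨n, hn1, hn2⟩ := (h.and (hlim.eventually_lt_const one_pos)).exists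
  have hpos : 0 < a ^ n := pow_pos ha n
  rw [div_pow, ← mul_div_assoc, div_lt_one hpos] at hn2
  exact absurd hn1 (not_le.2 hn2)

/-- The averages of `log b` along `i` stay in one compact interval, so a finite `ε`-net of it serves
all `n` at once. -/
theorem exists_finset_log_prod_near {b : Fin d → ℝ} {ε : ℝ} (hε : 0 < ε) :
    ∃ J : Finset ℝ, ∀ n : ℕ, 1 ≤ n → ∀ i : Fin n → Fin d, ∃ s ∈ J,
      |∑ k, Real.log (b (i k)) - n * s| ≤ ε * n := by
  set R := ∑ x, |Real.log (b x)| with hR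
  obtain ⟨J, -, hJ, hcov⟩ := (isCompact_Icc : IsCompact (Set.Icc (-R) R)).finite_cover_balls hε
  refine ⟨hJ.toFinset, fun n hn i => ?_⟩
  have hn0 : (0 : ℝ) < n := by exact_mod_cast hn
  have hle : |∑ k, Real.log (b (i k))| ≤ n * R := by
    refine (Finset.abs_sum_le_sum_abs _ _).trans ?_
    calc ∑ k, |Real.log (b (i k))| ≤ ∑ _k : Fin n, R := Finset.sum_le_sum fun k _ =>
          Finset.single_le_sum (f := fun x => |Real.log (b x)|) (fun x _ => abs_nonneg _)
            (Finset.mem_univ (i k))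
      _ = n * R := by simp
  have hmem : (∑ k, Real.log (b (i k))) / n ∈ Set.Icc (-R) R := by
    rw [abs_le] at hle
    constructor
    · rw [le_div_iff₀ hn0]
      linarith
    · rw [div_le_iff₀ hn0]
      linarith
  obtain ⟨s, hs, hball⟩ := Set.mem_iUnion₂.1 (hcov hmem)
  refine ⟨s, hJ.mem_toFinset.2 hs, ?_⟩
  rw [Metric.mem_ball, Real.dist_eq] at hball
  have heq : ∑ k, Real.log (b (i k)) - n * s = n * ((∑ k, Real.log (b (i k))) / n - s) := by
    field_simp
  rw [heq, abs_mul, abs_of_pos hn0, mul_comm ε]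
  gcongr

/-- At the scale `c = e^{-s}` matched to `W = log ∏ b`, both summands on the left are at most
`e^{εn}`. The exponent `3ε` collects the prefactor, the mismatch `W - ns`, and `t` times that
mismatch on the right. -/
theorem exp_scale_bound {t W s ε : ℝ} (n : ℕ) (ht0 : 0 < t) (ht1 : t < 1) (hε : 0 < ε)
    (h : |W - n * s| ≤ ε * n) :
    Real.exp (ε * n) * (Real.exp (-s) ^ n * Real.exp W + 1) ≤
      (Real.exp (-s) ^ t) ^ n * (2 * Real.exp (3 * ε * n) * Real.exp (t * W)) := by
  obtain ⟨h1, h2⟩ := abs_le.1 h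
  have hεn : 0 ≤ ε * n := by positivity
  have e1 : Real.exp (-s) ^ n * Real.exp W ≤ Real.exp (ε * n) := by
    rw [← Real.exp_nat_mul, ← Real.exp_add]
    exact Real.exp_le_exp.2 (by linarith)
  have e2 : (1 : ℝ) ≤ Real.exp (ε * n) := Real.one_le_exp hεn
  have e3 : Real.exp (ε * n) * Real.exp (ε * n) ≤
      (Real.exp (-s) ^ t) ^ n * (Real.exp (3 * ε * n) * Real.exp (t * W)) := by
    rw [← Real.exp_mul, ← Real.exp_nat_mul, ← Real.exp_add, ← Real.exp_add, ← Real.exp_add]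
    refine Real.exp_le_exp.2 ?_
    nlinarith
  calc _ ≤ Real.exp (ε * n) * (Real.exp (ε * n) + Real.exp (ε * n)) := by gcongr
    _ = 2 * (Real.exp (ε * n) * Real.exp (ε * n)) := by ring
    _ ≤ 2 * ((Real.exp (-s) ^ t) ^ n * (Real.exp (3 * ε * n) * Real.exp (t * W))) := by gcongr
    _ = _ := by ring

/-- A fixed `c` only gives an arithmetic bound; the geometric one appears because `c` may be chosen
separately on each block of coordinates with nearly constant `∏ b`. -/
theorem qform_le_sum_rpow {t : ℝ} (ht0 : 0 < t) (ht1 : t < 1) {X : Op d} (hX : X.PosSemidef)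
    {b : Fin d → ℝ} (hb : ∀ i, 0 < b i)
    (h : ∀ c : ℝ, 0 < c → ∀ ε : ℝ, 0 < ε → ∀ᶠ n : ℕ in atTop, ∀ v,
      (c ^ t) ^ n * qform (tensorPow X n) v ≤
        Real.exp (ε * n) * ∑ i, (c ^ n * ∏ k, b (i k) + 1) * ‖v i‖ ^ 2)
    (ψ : Fin d → ℂ) : qform X ψ ≤ ∑ i, b i ^ t * ‖ψ i‖ ^ 2 := by
  set Q := ∑ i, b i ^ t * ‖ψ i‖ ^ 2 with hQ
  have hQ0 : 0 ≤ Q := Finset.sum_nonneg fun i _ =>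
    mul_nonneg (Real.rpow_nonneg (hb i).le t) (sq_nonneg _)
  have key : ∀ ε : ℝ, 0 < ε → qform X ψ ≤ Real.exp (3 * ε) * Q := by
    intro ε hε
    obtain ⟨J, hJ⟩ := exists_finset_log_prod_near (b := b) hε
    refine le_of_eventually_pow_le_const_mul_pow (C := J.card * 2)
      (mul_nonneg (Real.exp_pos _).le hQ0) ?_
    -- The threshold in `h` depends on `c`; finiteness of `J` provides a common one.
    have hev := (eventually_all_finset J).2 fun s _ => h (Real.exp (-s)) (Real.exp_pos _) ε hε
    filter_upwards [hev, eventually_ge_atTop 1] with n hn hn1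
    choose κ hκJ hκ using hJ n hn1
    set v : (Fin n → Fin d) → ℂ := fun i => ∏ k, ψ (i k) with hv
    -- `p s` is the part of `ψ^{⊗n}` on the block assigned to `s`.
    set p : ℝ → (Fin n → Fin d) → ℂ := fun s i => if κ i = s then v i else 0 with hp
    have hvp : v = ∑ s ∈ J, p s := by
      ext i
      simp [hp, Finset.sum_apply, hκJ i]
    have hpart : ∀ s ∈ J, qform (tensorPow X n) (p s) ≤
        ∑ i, 2 * Real.exp (3 * ε * n) * Real.exp (t * ∑ k, Real.log (b (i k))) * ‖p s i‖ ^ 2 := by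
      intro s hs
      have hpos : 0 < (Real.exp (-s) ^ t) ^ n :=
        pow_pos (Real.rpow_pos_of_pos (Real.exp_pos _) t) n
      refine le_of_mul_le_mul_left ((hn s hs (p s)).trans ?_) hpos
      rw [Finset.mul_sum, Finset.mul_sum]
      refine Finset.sum_le_sum fun i _ => ?_
      by_cases hi : κ i = s
      · have hw : ∏ k, b (i k) = Real.exp (∑ k, Real.log (b (i k))) := by
          rw [Real.exp_sum]
          exact Finset.prod_congr rfl fun k _ => (Real.exp_log (hb _)).symm
        rw [← mul_assoc, ← mul_assoc, hw]
        exact mul_le_mul_of_nonneg_right (exp_scale_bound n ht0 ht1 hε (hi ▸ hκ i)) (sq_nonneg _)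
      · simp [hp, hi]
    calc qform X ψ ^ n = qform (tensorPow X n) v := (qform_tensorPow hX ψ n).symm
      _ ≤ J.card * ∑ s ∈ J, qform (tensorPow X n) (p s) := by
        rw [hvp]
        exact qform_sum_le (tensorPow_posSemidef hX n) J p
      _ ≤ J.card * ∑ s ∈ J, ∑ i : Fin n → Fin d, 2 * Real.exp (3 * ε * n) *
          Real.exp (t * ∑ k, Real.log (b (i k))) * ‖p s i‖ ^ 2 := by
        gcongr with s hs
        exact hpart s hs
      _ = J.card * ∑ i : Fin n → Fin d, 2 * Real.exp (3 * ε * n) *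
          Real.exp (t * ∑ k, Real.log (b (i k))) * ‖v i‖ ^ 2 := by
        rw [Finset.sum_comm]
        congr 1
        refine Finset.sum_congr rfl fun i _ => ?_
        rw [← Finset.mul_sum]
        congr 1
        -- The blocks are disjoint, so each coordinate occurs for exactly one `s`.
        rw [Finset.sum_eq_single_of_mem (κ i) (hκJ i)]
        · simp [hp]
        · intro s _ hs
          simp [hp, hs.symm]
      _ = J.card * 2 * (Real.exp (3 * ε) ^ n *
          ∑ i : Fin n → Fin d, ∏ k, (b (i k) ^ t * ‖ψ (i k)‖ ^ 2)) := by
        rw [mul_assoc (J.card : ℝ) 2]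
        congr 1
        rw [Finset.mul_sum, Finset.mul_sum]
        refine Finset.sum_congr rfl fun i _ => ?_
        have e1 : Real.exp (3 * ε * n) = Real.exp (3 * ε) ^ n := by
          rw [← Real.exp_nat_mul, mul_comm]
        have e2 : Real.exp (t * ∑ k, Real.log (b (i k))) = ∏ k, b (i k) ^ t := by
          rw [Finset.mul_sum, Real.exp_sum]
          refine Finset.prod_congr rfl fun k _ => ?_
          rw [Real.rpow_def_of_pos (hb _), mul_comm]
        rw [e1, e2, hv, norm_prod, ← Finset.prod_pow, Finset.prod_mul_distrib]
        ring
      _ = J.card * 2 * (Real.exp (3 * ε) * Q) ^ n := by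
        rw [mul_pow, hQ]
        have := Finset.prod_univ_sum (fun _ : Fin n => (Finset.univ : Finset (Fin d)))
          (fun _ x => b x ^ t * ‖ψ x‖ ^ 2)
        rw [Finset.prod_const, Finset.card_univ, Fintype.card_fin, Fintype.piFinset_univ] at this
        rw [this]
  have hlim : Tendsto (fun ε : ℝ => Real.exp (3 * ε) * Q) (nhdsWithin 0 (Set.Ioi 0))
      (nhds (Real.exp (3 * 0) * Q)) :=
    ((Continuous.tendsto (by fun_prop) 0).mono_left nhdsWithin_le_nhds)
  rw [mul_zero, Real.exp_zero, one_mul] at hlim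
  exact ge_of_tendsto hlim (eventually_nhdsWithin_of_forall key)

theorem le_kuboAndo_of_eventually_le {t : ℝ} (ht0 : 0 < t) (ht1 : t < 1) {A₁ A₂ G : Op d}
    (h₁ : A₁.PosDef) (h₂ : A₂.PosDef) (hG : G.PosSemidef)
    (h : ∀ c : ℝ, 0 < c → ∀ ε : ℝ, 0 < ε → ∀ᶠ n : ℕ in atTop, ∀ v,
      qform (tensorPow (c ^ t • G) n) v ≤ Real.exp (ε * n) *
        (qform (tensorPow (c • A₁) n) v + qform (tensorPow A₂ n) v)) :
    G ≤ kuboAndo t A₂ A₁ := by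
  obtain ⟨S, hS, b, hb, hS₂, hS₁, hSK⟩ := exists_simultaneous_diag t h₁ h₂
  have hK := (kuboAndo_posDef t h₂ h₁).isHermitian
  refine le_of_qform_le hG.isHermitian hK fun φ => ?_
  obtain ⟨ψ, rfl⟩ : ∃ ψ, S *ᵥ ψ = φ := by
    obtain ⟨u, rfl⟩ := hS
    refine ⟨(↑u⁻¹ : Op d) *ᵥ φ, ?_⟩
    rw [Matrix.mulVec_mulVec, Units.mul_inv, Matrix.one_mulVec]
  rw [← qform_conj, ← qform_conj, hSK, qform_diagonal]
  refine qform_le_sum_rpow ht0 ht1 (hG.conjTranspose_mul_mul_same S) hb (fun c hc ε hε => ?_) ψ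
  filter_upwards [h c hc ε hε] with n hn v
  have := hn (tensorPow S n *ᵥ v)
  rw [tensorPow_smul, tensorPow_smul, qform_smul, qform_smul, ← qform_tensorPow_conj,
    ← qform_tensorPow_conj, ← qform_tensorPow_conj, hS₁, hS₂, tensorPow_one, tensorPow_diagonal,
    qform_one] at this
  refine this.trans_eq ?_
  have e := qform_diagonal (fun i : Fin n → Fin d => ∏ k, b (i k)) v
  push_cast at e
  rw [e, Finset.mul_sum, ← Finset.sum_add_distrib]
  congr 1
  exact Finset.sum_congr rfl fun i _ => by ring

/-- AM boundedness is used at all pairs `(c A₁, A₂)`, with measures that may change with `c`;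
homogeneity refers every instance back to `F d A₁ A₂`. -/
theorem le_kuboAndo_of_asympIndivAMBounded {t : ℝ} (ht0 : 0 < t) (ht1 : t < 1)
    {F : ∀ d : ℕ, Op d → Op d → Op d}
    {hpos : ∀ d (A₁ A₂ : Op d), A₁.PosDef → A₂.PosDef → (F d A₁ A₂).PosSemidef}
    {hconj : ∀ d (A₁ A₂ : Op d), A₁.PosDef → A₂.PosDef → ∀ V ∈ Matrix.unitaryGroup (Fin d) ℂ,
      F d (V * A₁ * Vᴴ) (V * A₂ * Vᴴ) = V * F d A₁ A₂ * Vᴴ}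
    (hF : (ofFormula F hpos hconj).AsympIndivAMBounded) (hd : 0 < d) {A₁ A₂ : Op d}
    (h₁ : A₁.PosDef) (h₂ : A₂.PosDef)
    (hsmul : ∀ c : ℝ, 0 < c → F d (c • A₁) A₂ = c ^ t • F d A₁ A₂) :
    F d A₁ A₂ ≤ kuboAndo t A₂ A₁ := by
  refine le_kuboAndo_of_eventually_le ht0 ht1 h₁ h₂ (hpos d _ _ h₁ h₂) fun c hc ε hε => ?_
  have hdom : ∀ y, (![c • A₁, A₂] y).PosDef := by
    intro y
    fin_cases y
    · exact h₁.smul hc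
    · exact h₂
  obtain ⟨μ, hμ, hlim⟩ := hF d ![c • A₁, A₂] ⟨hd, hdom⟩
  rw [← hsmul c hc]
  exact eventually_qform_tensorPow_le (fun y => (hdom y).posSemidef) hμ hlim hε

end KuboAndoBound

/-! ### Homogeneity of degree `t` in the first variable -/

section Scaling

variable {d : ℕ} {t z c : ℝ} {A₁ A₂ : Op d}

theorem kuboAndo_smul (h₁ : A₁.PosDef) (h₂ : A₂.PosDef) (hc : 0 < c) :
    kuboAndo t A₂ (c • A₁) = c ^ t • kuboAndo t A₂ A₁ := by
  rw [kuboAndo, mul_smul_comm, smul_mul_assoc,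
    mpow_smul (sandwich_posDef (mpow_posDef h₂ _) h₁) hc, mul_smul_comm, smul_mul_assoc, kuboAndo]

theorem meanGFun_smul (h₁ : A₁.PosDef) (h₂ : A₂.PosDef) (hz : 0 < z) (hc : 0 < c) :
    meanGFun t z (c • A₁) A₂ = c ^ t • meanGFun t z A₁ A₂ := by
  rw [meanGFun, mpow_smul h₁ hc, smul_mul_assoc, smul_mul_assoc, mul_smul_comm, smul_smul,
    mpow_smul (sandwich_posDef (mpow_posDef h₁ _) (mpow_posDef h₂ _)) (by positivity), meanGFun,
    ← Real.rpow_add hc, ← Real.rpow_mul hc.le]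
  congr 2
  field_simp
  ring

theorem meanGTildeFun_smul (h₁ : A₁.PosDef) (h₂ : A₂.PosDef) (hz : 0 < z) (hc : 0 < c) :
    meanGTildeFun t z (c • A₁) A₂ = c ^ t • meanGTildeFun t z A₁ A₂ := by
  rw [meanGTildeFun, mpow_smul h₁ hc, mul_smul_comm, smul_mul_assoc,
    mpow_smul (sandwich_posDef (mpow_posDef h₂ _) (mpow_posDef h₁ _)) (by positivity),
    meanGTildeFun, ← Real.rpow_mul hc.le, div_mul_cancel₀ _ hz.ne']

theorem meanGHatFun_smul (h₁ : A₁.PosDef) (h₂ : A₂.PosDef) (hz : 0 < z) (hc : 0 < c) :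
    meanGHatFun t z (c • A₁) A₂ = c ^ t • meanGHatFun t z A₁ A₂ := by
  rw [meanGHatFun, mpow_smul h₁ hc,
    kuboAndo_smul (mpow_posDef h₁ _) (mpow_posDef h₂ _) (by positivity),
    mpow_smul (kuboAndo_posDef t (mpow_posDef h₂ _) (mpow_posDef h₁ _)) (by positivity),
    meanGHatFun, ← Real.rpow_mul hc.le, ← Real.rpow_mul hc.le]
  congr 2
  field_simp

theorem isHermitian_smul_mlog_add (s t : ℝ) (A₁ A₂ : Op d) :
    (s • mlog A₁ + t • mlog A₂).IsHermitian := by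
  have e₁ : IsSelfAdjoint (mlog A₁) := cfc_predicate _ _
  have e₂ : IsSelfAdjoint (mlog A₂) := cfc_predicate _ _
  exact ((IsSelfAdjoint.all s).smul e₁).add ((IsSelfAdjoint.all t).smul e₂)

theorem meanGHatTopFun_smul (h₁ : A₁.PosDef) (hc : 0 < c) :
    meanGHatTopFun t (c • A₁) A₂ = c ^ t • meanGHatTopFun t A₁ A₂ := by
  rw [meanGHatTopFun, mlog_smul h₁ hc, smul_add, smul_smul, add_assoc,
    mexp_smul_one_add (isHermitian_smul_mlog_add _ _ _ _), meanGHatTopFun,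
    Real.rpow_def_of_pos hc, mul_comm t]

end Scaling

/-! ### Explicit calculus for real symmetric 2 × 2 matrices -/

section Bloch

/-- The real symmetric `2 × 2` matrix `c I + x σ_z + y σ_x`. -/
noncomputable def bloch (c x y : ℝ) : Op 2 :=
  !![((c + x : ℝ) : ℂ), (y : ℂ); (y : ℂ), ((c - x : ℝ) : ℂ)]

theorem bloch_isHermitian (c x y : ℝ) : (bloch c x y).IsHermitian := by
  ext i j
  fin_cases i <;> fin_cases j <;> simp [bloch]

theorem bloch_det (c x y : ℝ) : (bloch c x y).det = ((c ^ 2 - x ^ 2 - y ^ 2 : ℝ) : ℂ) := by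
  rw [bloch, Matrix.det_fin_two_of]
  push_cast
  ring

/-- The off-diagonal entry of the commutator is a multiple of the cross product of the two vectors.
-/
theorem bloch_commute {c x y c' x' y' : ℝ}
    (h : bloch c x y * bloch c' x' y' = bloch c' x' y' * bloch c x y) : x * y' = x' * y := by
  have h01 := congrFun (congrFun h 0) 1
  simp only [bloch, Matrix.mul_apply, Fin.sum_univ_two, Matrix.of_apply, Matrix.cons_val_zero,
    Matrix.cons_val_one] at h01
  norm_cast at h01
  linarith

theorem mem_spectrum_bloch {c x y r u : ℝ} (hr : r ^ 2 = x ^ 2 + y ^ 2)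
    (hu : u ∈ spectrum ℝ (bloch c x y)) : u = c + r ∨ u = c - r := by
  have hdet : (algebraMap ℝ (Op 2) u - bloch c x y).det = 0 := by
    by_contra hne
    exact hu ((Matrix.isUnit_iff_isUnit_det _).2 (isUnit_iff_ne_zero.2 hne))
  have heq : algebraMap ℝ (Op 2) u - bloch c x y = bloch (u - c) (-x) (-y) := by
    ext i j
    fin_cases i <;> fin_cases j <;> simp [bloch, Matrix.algebraMap_matrix_apply] <;> ring
  rw [heq, bloch_det] at hdet
  have h0 : (u - c) ^ 2 - (-x) ^ 2 - (-y) ^ 2 = 0 := by exact_mod_cast hdet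
  have h1 : (u - (c + r)) * (u - (c - r)) = 0 := by linear_combination h0 + hr * (-1)
  rcases mul_eq_zero.1 h1 with h | h
  · exact Or.inl (sub_eq_zero.1 h)
  · exact Or.inr (sub_eq_zero.1 h)

/-- The spectrum lies in `{c + r, c - r}`, where `f` agrees with its affine interpolant. Either sign
of `r` is allowed. -/
theorem cfc_bloch (f : ℝ → ℝ) {c x y r : ℝ} (hr : r ^ 2 = x ^ 2 + y ^ 2) (hr0 : r ≠ 0) :
    cfc f (bloch c x y) = bloch ((f (c + r) + f (c - r)) / 2)
      ((f (c + r) - f (c - r)) / (2 * r) * x) ((f (c + r) - f (c - r)) / (2 * r) * y) := by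
  have hA : IsSelfAdjoint (bloch c x y) := bloch_isHermitian c x y
  set δ := (f (c + r) - f (c - r)) / (2 * r) with hδ
  set m := (f (c + r) + f (c - r)) / 2 with hm
  have h1 : cfc f (bloch c x y) = cfc (fun u : ℝ => (m - δ * c) + δ * u) (bloch c x y) := by
    refine cfc_congr fun u hu => ?_
    rcases mem_spectrum_bloch hr hu with rfl | rfl
    · simp only [hδ, hm]
      field_simp
      ring
    · simp only [hδ, hm]
      field_simp
      ring
  rw [h1, cfc_const_add _ _ _, cfc_const_mul_id δ _, Algebra.algebraMap_eq_smul_one]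
  ext i j
  fin_cases i <;> fin_cases j <;> simp [bloch] <;> ring

theorem bloch_commute_of_cfc_eq {f : ℝ → ℝ} {c x y c' x' y' : ℝ}
    (h : cfc f (bloch c x y) = bloch c' x' y') : x * y' = x' * y := by
  have hA : IsSelfAdjoint (bloch c x y) := bloch_isHermitian c x y
  have hc := cfc_commute_cfc (fun u : ℝ => u) f (bloch c x y)
  rw [cfc_id' ℝ (bloch c x y), h] at hc
  exact bloch_commute hc

theorem mpow_bloch {β x y : ℝ} (hβ : β ≠ 0) (h : Real.sinh β ^ 2 = x ^ 2 + y ^ 2) (p : ℝ) :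
    mpow (bloch (Real.cosh β) x y) p = bloch (Real.cosh (p * β))
      (Real.sinh (p * β) / Real.sinh β * x) (Real.sinh (p * β) / Real.sinh β * y) := by
  have hs : Real.sinh β ≠ 0 := by simpa using hβ
  rw [mpow, cfc_bloch _ h hs, Real.cosh_add_sinh, Real.cosh_sub_sinh, ← Real.exp_mul,
    ← Real.exp_mul, Real.cosh_eq (p * β), Real.sinh_eq (p * β), neg_mul, mul_comm β p]
  congr 1 <;> field_simp

/-- The positive matrix `exp (a σ_z)`. -/
noncomputable def expZ (a : ℝ) : Op 2 := bloch (Real.cosh a) (Real.sinh a) 0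

/-- The positive matrix `exp (b σ_x)`. -/
noncomputable def expX (b : ℝ) : Op 2 := bloch (Real.cosh b) 0 (Real.sinh b)

theorem mpow_expZ {a : ℝ} (ha : a ≠ 0) (p : ℝ) : mpow (expZ a) p = expZ (p * a) := by
  have hs : Real.sinh a ≠ 0 := by simpa using ha
  rw [expZ, mpow_bloch ha (by ring), div_mul_cancel₀ _ hs, mul_zero, expZ]

theorem mpow_expX {b : ℝ} (hb : b ≠ 0) (p : ℝ) : mpow (expX b) p = expX (p * b) := by
  have hs : Real.sinh b ≠ 0 := by simpa using hb
  rw [expX, mpow_bloch hb (by ring), div_mul_cancel₀ _ hs, mul_zero, expX]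

theorem mlog_expZ {a : ℝ} (ha : a ≠ 0) : mlog (expZ a) = bloch 0 a 0 := by
  have hs : Real.sinh a ≠ 0 := by simpa using ha
  rw [mlog, expZ, cfc_bloch (r := Real.sinh a) _ (by ring) hs, Real.cosh_add_sinh,
    Real.cosh_sub_sinh, Real.log_exp, Real.log_exp]
  congr 1 <;> field_simp <;> ring

theorem mlog_expX {b : ℝ} (hb : b ≠ 0) : mlog (expX b) = bloch 0 0 b := by
  have hs : Real.sinh b ≠ 0 := by simpa using hb
  rw [mlog, expX, cfc_bloch (r := Real.sinh b) _ (by ring) hs, Real.cosh_add_sinh,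
    Real.cosh_sub_sinh, Real.log_exp, Real.log_exp]
  congr 1 <;> field_simp <;> ring

theorem expZ_posDef (a : ℝ) : (expZ a).PosDef := by
  refine (bloch_isHermitian _ _ _).posDef_iff_eigenvalues_pos.2 fun i => ?_
  have hr : Real.sinh a ^ 2 = Real.sinh a ^ 2 + 0 ^ 2 := by ring
  rcases mem_spectrum_bloch hr ((bloch_isHermitian _ _ _).eigenvalues_mem_spectrum_real i) with h | h
  · rw [h, Real.cosh_add_sinh]
    exact Real.exp_pos _
  · rw [h, Real.cosh_sub_sinh]
    exact Real.exp_pos _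

theorem expX_posDef (b : ℝ) : (expX b).PosDef := by
  refine (bloch_isHermitian _ _ _).posDef_iff_eigenvalues_pos.2 fun i => ?_
  have hr : Real.sinh b ^ 2 = 0 ^ 2 + Real.sinh b ^ 2 := by ring
  rcases mem_spectrum_bloch hr ((bloch_isHermitian _ _ _).eigenvalues_mem_spectrum_real i) with h | h
  · rw [h, Real.cosh_add_sinh]
    exact Real.exp_pos _
  · rw [h, Real.cosh_sub_sinh]
    exact Real.exp_pos _

theorem expZ_det (a : ℝ) : (expZ a).det = 1 := by
  rw [expZ, bloch_det, ← Complex.ofReal_one, ← Real.cosh_sq_sub_sinh_sq a]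
  congr 1
  ring

theorem expX_det (b : ℝ) : (expX b).det = 1 := by
  rw [expX, bloch_det, ← Complex.ofReal_one, ← Real.cosh_sq_sub_sinh_sq b]
  congr 1
  ring

theorem expZ_mul_bloch_mul_expZ (u c x y : ℝ) : expZ u * bloch c x y * expZ u =
    bloch (c * Real.cosh (2 * u) + x * Real.sinh (2 * u))
      (c * Real.sinh (2 * u) + x * Real.cosh (2 * u)) y := by
  have h := Real.cosh_sq_sub_sinh_sq u
  rw [Real.cosh_two_mul, Real.sinh_two_mul]
  ext i j
  fin_cases i <;> fin_cases j <;>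
    simp only [expZ, bloch, Matrix.mul_apply, Fin.sum_univ_two, Matrix.of_apply, Fin.zero_eta,
      Fin.mk_one, Matrix.cons_val_zero, Matrix.cons_val_one] <;> norm_cast
  · ring
  · linear_combination y * h
  · linear_combination y * h
  · ring

theorem expX_mul_bloch_mul_expX (u c x y : ℝ) : expX u * bloch c x y * expX u =
    bloch (c * Real.cosh (2 * u) + y * Real.sinh (2 * u)) x
      (c * Real.sinh (2 * u) + y * Real.cosh (2 * u)) := by
  have h := Real.cosh_sq_sub_sinh_sq u
  rw [Real.cosh_two_mul, Real.sinh_two_mul]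
  ext i j
  fin_cases i <;> fin_cases j <;>
    simp only [expX, bloch, Matrix.mul_apply, Fin.sum_univ_two, Matrix.of_apply, Fin.zero_eta,
      Fin.mk_one, Matrix.cons_val_zero, Matrix.cons_val_one] <;> norm_cast
  · linear_combination x * h
  · ring
  · ring
  · linear_combination -x * h

/-- The middle factor `A₂^{-1/2} A₁ A₂^{-1/2}` has determinant 1 and half-trace `cosh a cosh b`,
hence eigenvalues `e^{±β}`. The scalar part `c` is irrelevant: only the direction of the vector is
compared later. -/
theorem kuboAndo_expX_expZ (t : ℝ) {a b β : ℝ} (hb : b ≠ 0) (hβ : β ≠ 0)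
    (h : Real.cosh β = Real.cosh a * Real.cosh b) :
    ∃ c, kuboAndo t (expX b) (expZ a) = bloch c (Real.sinh (t * β) / Real.sinh β * Real.sinh a)
      (Real.sinh ((1 - t) * β) / Real.sinh β * Real.sinh b) := by
  have hs : Real.sinh β ≠ 0 := by simpa using hβ
  have e1 : 2 * (-(1 / 2) * b) = -b := by ring
  have e2 : 2 * (1 / 2 * b) = b := by ring
  have hsq : Real.sinh β ^ 2 = Real.sinh a ^ 2 + (Real.cosh a * Real.sinh (-b)) ^ 2 := by
    rw [Real.sinh_neg]
    linear_combination Real.cosh a ^ 2 * Real.cosh_sq_sub_sinh_sq b + Real.cosh_sq_sub_sinh_sq a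
      - Real.cosh_sq_sub_sinh_sq β + (Real.cosh β + Real.cosh a * Real.cosh b) * h
  have hsub : Real.sinh ((1 - t) * β) =
      Real.sinh β * Real.cosh (t * β) - Real.cosh β * Real.sinh (t * β) := by
    rw [← Real.sinh_sub]
    congr 1
    ring
  rw [kuboAndo, mpow_expX hb, mpow_expX hb, expZ, expX_mul_bloch_mul_expX, e1, zero_mul, zero_mul,
    add_zero, add_zero, Real.cosh_neg, ← h, mpow_bloch hβ hsq, expX_mul_bloch_mul_expX, e2]
  refine ⟨_, congrArg _ ?_⟩
  rw [hsub, Real.sinh_neg]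
  field_simp
  rw [h]
  ring

theorem exists_cosh_eq_cosh_mul_cosh {a : ℝ} (ha : 0 < a) (b : ℝ) :
    ∃ β, 0 < β ∧ Real.cosh β = Real.cosh a * Real.cosh b := by
  have h1 : 1 < Real.cosh a * Real.cosh b :=
    one_lt_mul_of_lt_of_le (Real.one_lt_cosh.2 ha.ne') (Real.one_le_cosh b)
  exact ⟨Real.arcosh (Real.cosh a * Real.cosh b), Real.arcosh_pos h1, Real.cosh_arcosh h1.le⟩

end Bloch

/-! ### Growth of the Kubo-Ando slope -/

section Growth

variable {t a b β : ℝ}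

theorem exp_le_sinh {s u : ℝ} (h : s ≤ u) :
    (1 - Real.exp (-2 * s)) / 2 * Real.exp u ≤ Real.sinh u := by
  have h1 : Real.exp (-u) ≤ Real.exp (-2 * s) * Real.exp u := by
    rw [← Real.exp_add]
    exact Real.exp_le_exp.2 (by linarith)
  rw [Real.sinh_eq]
  linarith

theorem sinh_le_exp (u : ℝ) : Real.sinh u ≤ Real.exp u := by
  rw [Real.sinh_eq]
  linarith [Real.exp_pos u, Real.exp_pos (-u)]

theorem half_one_sub_exp_pos {s : ℝ} (hs : 0 < s) : 0 < (1 - Real.exp (-2 * s)) / 2 := by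
  have : Real.exp (-2 * s) < Real.exp 0 := Real.exp_lt_exp.2 (by linarith)
  rw [Real.exp_zero] at this
  linarith

theorem le_of_cosh_eq_cosh_mul_cosh (ha : 0 < a) (hβ : 0 < β)
    (h : Real.cosh β = Real.cosh a * Real.cosh b) : a ≤ β := by
  have h1 : Real.cosh a ≤ Real.cosh β := by
    rw [h]
    exact le_mul_of_one_le_right (Real.cosh_pos a).le (Real.one_le_cosh b)
  rwa [Real.cosh_le_cosh, abs_of_pos ha, abs_of_pos hβ] at h1

theorem le_add_of_cosh_eq_cosh_mul_cosh (ha : 0 < a) (hb : 0 < b) (hβ : 0 < β)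
    (h : Real.cosh β = Real.cosh a * Real.cosh b) : β ≤ a + b := by
  have h1 : Real.cosh β ≤ Real.cosh (a + b) := by
    rw [h, Real.cosh_add]
    exact le_add_of_nonneg_right
      (mul_pos (Real.sinh_pos_iff.2 ha) (Real.sinh_pos_iff.2 hb)).le
  rwa [Real.cosh_le_cosh, abs_of_pos hβ, abs_of_pos (add_pos ha hb)] at h1

/-- Since `a ≤ β ≤ a + b`, each `sinh` is comparable to its exponential, and the exponents combine
to `ta + a - (1-t)a = 2ta`. The `b`-dependent factor in the constant pays for replacing `β` by `a +
b`. -/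
theorem exists_lower_growth (ht0 : 0 < t) (ht1 : t < 1) (hb : 0 < b) :
    ∃ c, 0 < c ∧ ∀ a, 1 ≤ a → ∀ β, 0 < β → Real.cosh β = Real.cosh a * Real.cosh b →
      c * Real.exp (2 * t * a) * Real.sinh ((1 - t) * β) ≤ Real.sinh (t * β) * Real.sinh a := by
  have hκt := half_one_sub_exp_pos ht0
  have hκ1 := half_one_sub_exp_pos one_pos
  set κt := (1 - Real.exp (-2 * t)) / 2
  set κ1 := (1 - Real.exp (-2 * 1)) / 2
  refine ⟨κt * κ1 * Real.exp (-(1 - t) * b), by positivity, fun a ha β hβ h => ?_⟩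
  have ha0 : 0 < a := by linarith
  have h1 := le_of_cosh_eq_cosh_mul_cosh ha0 hβ h
  have h2 := le_add_of_cosh_eq_cosh_mul_cosh ha0 hb hβ h
  have e1 : Real.sinh ((1 - t) * β) ≤ Real.exp ((1 - t) * (a + b)) :=
    (sinh_le_exp _).trans (Real.exp_le_exp.2 (by nlinarith))
  calc _ ≤ κt * κ1 * Real.exp (-(1 - t) * b) * Real.exp (2 * t * a) *
        Real.exp ((1 - t) * (a + b)) := by gcongr
    _ = (κt * Real.exp (t * a)) * (κ1 * Real.exp a) := by
      have : Real.exp (-(1 - t) * b) * Real.exp (2 * t * a) * Real.exp ((1 - t) * (a + b)) =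
          Real.exp (t * a) * Real.exp a := by
        rw [← Real.exp_add, ← Real.exp_add, ← Real.exp_add]
        congr 1
        ring
      linear_combination κt * κ1 * this
    _ ≤ Real.sinh (t * β) * Real.sinh a := by
      refine mul_le_mul ?_ (exp_le_sinh ha) (by positivity)
        (Real.sinh_pos_iff.2 (by positivity)).le
      refine (exp_le_sinh ?_).trans (Real.sinh_le_sinh.2 (by gcongr))
      exact le_mul_of_one_le_right ht0.le ha

theorem exists_upper_growth (ht0 : 0 < t) (ht1 : t < 1) (hb : 0 < b) :
    ∃ C, 0 < C ∧ ∀ a, 1 ≤ a → ∀ β, 0 < β → Real.cosh β = Real.cosh a * Real.cosh b →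
      Real.sinh (t * β) * Real.sinh a ≤ C * Real.exp (2 * t * a) * Real.sinh ((1 - t) * β) := by
  have ht : 0 < 1 - t := sub_pos.2 ht1
  have hκ := half_one_sub_exp_pos ht
  set κ := (1 - Real.exp (-2 * (1 - t))) / 2
  refine ⟨Real.exp (t * b) / κ, by positivity, fun a ha β hβ h => ?_⟩
  have ha0 : 0 < a := by linarith
  have h1 := le_of_cosh_eq_cosh_mul_cosh ha0 hβ h
  have h2 := le_add_of_cosh_eq_cosh_mul_cosh ha0 hb hβ h
  have e1 : Real.sinh (t * β) ≤ Real.exp (t * (a + b)) :=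
    (sinh_le_exp _).trans (Real.exp_le_exp.2 (by gcongr))
  have e2 : κ * Real.exp ((1 - t) * a) ≤ Real.sinh ((1 - t) * β) :=
    (exp_le_sinh (le_mul_of_one_le_right ht.le ha)).trans (Real.sinh_le_sinh.2 (by gcongr))
  calc _ ≤ Real.exp (t * (a + b)) * Real.exp a :=
        mul_le_mul e1 (sinh_le_exp a) (Real.sinh_pos_iff.2 ha0).le (Real.exp_pos _).le
    _ = Real.exp (t * b) / κ * Real.exp (2 * t * a) * (κ * Real.exp ((1 - t) * a)) := by
      have : Real.exp (t * (a + b)) * Real.exp a =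
          Real.exp (t * b) * Real.exp (2 * t * a) * Real.exp ((1 - t) * a) := by
        rw [← Real.exp_add, ← Real.exp_add, ← Real.exp_add]
        congr 1
        ring
      rw [this]
      field_simp
    _ ≤ _ := by gcongr

theorem eventually_linear_lt (ht0 : 0 < t) (ht1 : t < 1) (hb : 0 < b) (C : ℝ) :
    ∀ᶠ a in atTop, ∀ β, 0 < β → Real.cosh β = Real.cosh a * Real.cosh b →
      C * a * Real.sinh ((1 - t) * β) < Real.sinh (t * β) * Real.sinh a := by
  obtain ⟨c, hc, h⟩ := exists_lower_growth ht0 ht1 hb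
  -- The threshold is where the quadratic Taylor term `c (2ta)² / 2` of the exponential overtakes `C
  -- a`.
  filter_upwards [eventually_ge_atTop 1, eventually_gt_atTop (C / (2 * c * t ^ 2))]
    with a ha haC β hβ hcosh
  have hs : 0 < Real.sinh ((1 - t) * β) := Real.sinh_pos_iff.2 (mul_pos (sub_pos.2 ht1) hβ)
  refine lt_of_lt_of_le ?_ (h a ha β hβ hcosh)
  refine mul_lt_mul_of_pos_right ?_ hs
  have hq := Real.quadratic_le_exp_of_nonneg (x := 2 * t * a) (by positivity)
  rw [div_lt_iff₀ (by positivity)] at haC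
  have h1 : 2 * t ^ 2 * a ^ 2 ≤ Real.exp (2 * t * a) := by
    have : 0 ≤ t * a := by positivity
    linarith
  calc C * a < a * (2 * c * t ^ 2) * a := by gcongr
    _ = c * (2 * t ^ 2 * a ^ 2) := by ring
    _ ≤ _ := by gcongr

/-- The slopes at `a` and at `a / k` grow like `e^{2ta}` and `e^{2ta/k}`; for `k > 1` the
exponential gap beats any constant. -/
theorem eventually_scaled_lt {k b' : ℝ} (ht0 : 0 < t) (ht1 : t < 1) (hk : 1 < k) (hb : 0 < b)
    (hb' : 0 < b') (C : ℝ) :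
    ∀ᶠ a in atTop, ∀ β, 0 < β → Real.cosh β = Real.cosh a * Real.cosh b →
      ∀ β', 0 < β' → Real.cosh β' = Real.cosh (a / k) * Real.cosh b' →
      C * (Real.sinh (t * β') * Real.sinh (a / k)) * Real.sinh ((1 - t) * β) <
        Real.sinh (t * β) * Real.sinh a * Real.sinh ((1 - t) * β') := by
  obtain ⟨c, hc, hlow⟩ := exists_lower_growth ht0 ht1 hb
  obtain ⟨D, hD, hup⟩ := exists_upper_growth ht0 ht1 hb'
  have hk0 : 0 < k := by linarith
  have hm : 0 < 2 * t * (1 - 1 / k) :=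
    mul_pos (by positivity) (sub_pos.2 ((div_lt_one hk0).2 hk))
  have hexp : Tendsto (fun a : ℝ => Real.exp (2 * t * (1 - 1 / k) * a)) atTop atTop :=
    Real.tendsto_exp_atTop.comp (tendsto_id.const_mul_atTop hm)
  filter_upwards [eventually_ge_atTop 1, eventually_ge_atTop k,
    hexp.eventually_gt_atTop (|C| * D / c)] with a ha hak hlarge β hβ hcosh β' hβ' hcosh'
  have hs : 0 < Real.sinh ((1 - t) * β) := Real.sinh_pos_iff.2 (mul_pos (sub_pos.2 ht1) hβ)
  have hs' : 0 < Real.sinh ((1 - t) * β') := Real.sinh_pos_iff.2 (mul_pos (sub_pos.2 ht1) hβ')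
  have hpos : 0 ≤ Real.sinh (t * β') * Real.sinh (a / k) :=
    mul_nonneg (Real.sinh_nonneg_iff.2 (by positivity)) (Real.sinh_nonneg_iff.2 (by positivity))
  have e1 := hup (a / k) ((one_le_div hk0).2 hak) β' hβ' hcosh'
  have e2 := hlow a ha β hβ hcosh
  rw [div_lt_iff₀ hc] at hlarge
  have e3 : Real.exp (2 * t * (1 - 1 / k) * a) * Real.exp (2 * t * (a / k)) =
      Real.exp (2 * t * a) := by
    rw [← Real.exp_add]
    congr 1
    ring
  calc C * (Real.sinh (t * β') * Real.sinh (a / k)) * Real.sinh ((1 - t) * β)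
      ≤ |C| * (D * Real.exp (2 * t * (a / k)) * Real.sinh ((1 - t) * β')) *
          Real.sinh ((1 - t) * β) := by
        gcongr
        exact le_abs_self C
    _ = |C| * D * (Real.exp (2 * t * (a / k)) * Real.sinh ((1 - t) * β') *
          Real.sinh ((1 - t) * β)) := by ring
    _ < Real.exp (2 * t * (1 - 1 / k) * a) * c * (Real.exp (2 * t * (a / k)) *
          Real.sinh ((1 - t) * β') * Real.sinh ((1 - t) * β)) := by gcongr
    _ = c * Real.exp (2 * t * a) * Real.sinh ((1 - t) * β) * Real.sinh ((1 - t) * β') := by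
      rw [← e3]
      ring
    _ ≤ _ := by gcongr

end Growth

/-! ### Pairs at which the Kubo-Ando bound fails -/

section Witnesses

variable {t z : ℝ}

/-- Equal determinants turn the inequality into an equality; then the Kubo-Ando mean commutes with
the argument of `f`, so the two vectors are parallel, contrary to `hne`. -/
theorem not_le_kuboAndo_of_eq_cfc {G : Op 2} {f : ℝ → ℝ} {c x y a b β : ℝ} (hb : b ≠ 0)
    (hβ : 0 < β) (h : Real.cosh β = Real.cosh a * Real.cosh b)
    (hGf : G = cfc f (bloch c x y)) (hG : G.PosDef) (hdet : G.det = 1)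
    (hne : x * (Real.sinh ((1 - t) * β) * Real.sinh b) ≠ Real.sinh (t * β) * Real.sinh a * y) :
    ¬ G ≤ kuboAndo t (expX b) (expZ a) := by
  intro hle
  have hK := kuboAndo_posDef t (expX_posDef b) (expZ_posDef a)
  have hKdet : (kuboAndo t (expX b) (expZ a)).det = 1 := by
    have hB : ∀ p, (mpow (expX b) p).det = 1 := det_mpow (expX_posDef b) (expX_det b)
    rw [kuboAndo, Matrix.det_mul, Matrix.det_mul, hB, det_mpow
      (sandwich_posDef (mpow_posDef (expX_posDef b) _) (expZ_posDef a))
      (by rw [Matrix.det_mul, Matrix.det_mul, hB, expZ_det, one_mul, one_mul]), one_mul, one_mul]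
  have heq := eq_of_le_of_det_eq hG hK hle (hdet.trans hKdet.symm)
  obtain ⟨c', hc'⟩ := kuboAndo_expX_expZ t hb hβ.ne' h
  rw [hc', hGf] at heq
  have hs : Real.sinh β ≠ 0 := (Real.sinh_pos_iff.2 hβ).ne'
  have := bloch_commute_of_cfc_eq heq
  field_simp at this
  exact hne (by linear_combination this)

theorem exists_not_meanGFun_le_kuboAndo (ht0 : 0 < t) (ht1 : t < 1) (hz : 0 < z) :
    ∃ A₁ A₂ : Op 2, A₁.PosDef ∧ A₂.PosDef ∧ ¬ meanGFun t z A₁ A₂ ≤ kuboAndo t A₂ A₁ := by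
  have ht : 0 < 1 - t := sub_pos.2 ht1
  have hP : 0 < Real.sinh (2 * (t / (2 * z) * 1)) := Real.sinh_pos_iff.2 (by positivity)
  set P := Real.sinh (2 * (t / (2 * z) * 1))
  have hs1 : 0 < Real.sinh 1 := Real.sinh_pos_iff.2 one_pos
  -- Here `a = 1` is fixed and `b` grows, so the growth lemma is used with `t` and `1 - t`
  -- exchanged. The slope `x / y = P coth((1-t) b / z)` stays above `P`, while the Kubo-Ando slope
  -- tends to 0.
  obtain ⟨b, hb1, hb⟩ := ((eventually_ge_atTop (1 : ℝ)).and
    (eventually_linear_lt ht (by linarith) one_pos (Real.sinh 1 / P))).exists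
  have hb0 : 0 < b := by linarith
  obtain ⟨β, hβ, hcosh⟩ := exists_cosh_eq_cosh_mul_cosh one_pos b
  have hlt := hb β hβ (by rw [hcosh, mul_comm])
  rw [sub_sub_cancel] at hlt
  have hq : 0 < Real.sinh ((1 - t) / z * b) := Real.sinh_pos_iff.2 (by positivity)
  have hst : 0 < Real.sinh (t * β) := Real.sinh_pos_iff.2 (by positivity)
  have h₁ := expZ_posDef 1
  have h₂ := expX_posDef b
  have hM := sandwich_posDef (mpow_posDef h₁ (t / (2 * z))) (mpow_posDef h₂ ((1 - t) / z))
  refine ⟨expZ 1, expX b, h₁, h₂, not_le_kuboAndo_of_eq_cfc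
    (c := Real.cosh ((1 - t) / z * b) * Real.cosh (2 * (t / (2 * z) * 1)))
    (x := Real.cosh ((1 - t) / z * b) * P) (y := Real.sinh ((1 - t) / z * b))
    (f := fun x => x ^ z) hb0.ne' hβ hcosh ?_ (mpow_posDef hM z) (det_mpow hM ?_ z) (ne_of_gt ?_)⟩
  · rw [meanGFun, mpow_expZ one_ne_zero, mpow_expX hb0.ne', expX, expZ_mul_bloch_mul_expZ,
      zero_mul, zero_mul, add_zero, add_zero, mpow]
  · rw [Matrix.det_mul, Matrix.det_mul, det_mpow h₁ (expZ_det 1), det_mpow h₂ (expX_det b),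
      one_mul, one_mul]
  · have e1 : Real.sinh 1 * Real.sinh (t * β) ≤ P * (Real.sinh 1 / P * b * Real.sinh (t * β)) := by
      have : P * (Real.sinh 1 / P * b * Real.sinh (t * β)) =
          b * (Real.sinh 1 * Real.sinh (t * β)) := by field_simp
      rw [this]
      exact le_mul_of_one_le_left (by positivity) hb1
    have e2 : Real.sinh 1 * Real.sinh (t * β) <
        P * (Real.sinh ((1 - t) * β) * Real.sinh b) :=
      e1.trans_lt (mul_lt_mul_of_pos_left hlt hP)
    calc Real.sinh (t * β) * Real.sinh 1 * Real.sinh ((1 - t) / z * b)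
        = (Real.sinh 1 * Real.sinh (t * β)) * Real.sinh ((1 - t) / z * b) := by ring
      _ < (P * (Real.sinh ((1 - t) * β) * Real.sinh b)) * Real.cosh ((1 - t) / z * b) :=
        mul_lt_mul'' e2 (Real.sinh_lt_cosh _) (by positivity) hq.le
      _ = _ := by ring

theorem exists_not_meanGTildeFun_le_kuboAndo (ht0 : 0 < t) (ht1 : t < 1) (hz : 0 < z) :
    ∃ A₁ A₂ : Op 2, A₁.PosDef ∧ A₂.PosDef ∧ ¬ meanGTildeFun t z A₁ A₂ ≤ kuboAndo t A₂ A₁ := by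
  have ht : 0 < 1 - t := sub_pos.2 ht1
  have hP : 0 < Real.sinh (2 * ((1 - t) / (2 * z) * 1)) := Real.sinh_pos_iff.2 (by positivity)
  set P := Real.sinh (2 * ((1 - t) / (2 * z) * 1))
  have hs1 : 0 < Real.sinh 1 := Real.sinh_pos_iff.2 one_pos
  -- Now `a` grows with `b = 1` fixed: `x / y = tanh(t a / z) / P` remains bounded, while the
  -- Kubo-Ando slope does not.
  obtain ⟨a, ha1, ha⟩ := ((eventually_ge_atTop (1 : ℝ)).and
    (eventually_linear_lt ht0 ht1 one_pos (Real.sinh 1 / P))).exists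
  have ha0 : 0 < a := by linarith
  obtain ⟨β, hβ, hcosh⟩ := exists_cosh_eq_cosh_mul_cosh ha0 1
  have hlt := ha β hβ hcosh
  have hq : 0 < Real.sinh (t / z * a) := Real.sinh_pos_iff.2 (by positivity)
  have hst : 0 < Real.sinh ((1 - t) * β) := Real.sinh_pos_iff.2 (by positivity)
  have h₁ := expZ_posDef a
  have h₂ := expX_posDef 1
  have hM := sandwich_posDef (mpow_posDef h₂ ((1 - t) / (2 * z))) (mpow_posDef h₁ (t / z))
  refine ⟨expZ a, expX 1, h₁, h₂, not_le_kuboAndo_of_eq_cfc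
    (c := Real.cosh (t / z * a) * Real.cosh (2 * ((1 - t) / (2 * z) * 1)))
    (x := Real.sinh (t / z * a)) (y := Real.cosh (t / z * a) * P)
    (f := fun x => x ^ z) one_ne_zero hβ hcosh ?_ (mpow_posDef hM z) (det_mpow hM ?_ z)
    (ne_of_lt ?_)⟩
  · rw [meanGTildeFun, mpow_expX one_ne_zero, mpow_expZ ha0.ne', expZ, expX_mul_bloch_mul_expX,
      zero_mul, zero_mul, add_zero, add_zero, mpow]
  · rw [Matrix.det_mul, Matrix.det_mul, det_mpow h₁ (expZ_det a), det_mpow h₂ (expX_det 1),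
      one_mul, one_mul]
  · have e1 : Real.sinh 1 * Real.sinh ((1 - t) * β) ≤
        P * (Real.sinh 1 / P * a * Real.sinh ((1 - t) * β)) := by
      have : P * (Real.sinh 1 / P * a * Real.sinh ((1 - t) * β)) =
          a * (Real.sinh 1 * Real.sinh ((1 - t) * β)) := by field_simp
      rw [this]
      exact le_mul_of_one_le_left (by positivity) ha1
    have e2 : Real.sinh 1 * Real.sinh ((1 - t) * β) <
        P * (Real.sinh (t * β) * Real.sinh a) :=
      e1.trans_lt (mul_lt_mul_of_pos_left hlt hP)
    calc Real.sinh (t / z * a) * (Real.sinh ((1 - t) * β) * Real.sinh 1)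
        = (Real.sinh 1 * Real.sinh ((1 - t) * β)) * Real.sinh (t / z * a) := by ring
      _ < (P * (Real.sinh (t * β) * Real.sinh a)) * Real.cosh (t / z * a) :=
        mul_lt_mul'' e2 (Real.sinh_lt_cosh _) (by positivity) hq.le
      _ = _ := by ring

/-- The matrix raised to the power `z` is itself a Kubo-Ando mean, at parameters `(a/z, 1/z)`. Its
slope grows like `e^{2ta/z}` against `e^{2ta}`, so the two differ for large `a` on either side of `z
= 1`. -/
theorem exists_not_meanGHatFun_le_kuboAndo (ht0 : 0 < t) (ht1 : t < 1) (hz : 0 < z)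
    (hz1 : z ≠ 1) :
    ∃ A₁ A₂ : Op 2, A₁.PosDef ∧ A₂.PosDef ∧ ¬ meanGHatFun t z A₁ A₂ ≤ kuboAndo t A₂ A₁ := by
  have hs : 0 < Real.sinh 1 := Real.sinh_pos_iff.2 one_pos
  have hsz : 0 < Real.sinh (1 / z * 1) := Real.sinh_pos_iff.2 (by positivity)
  obtain ⟨a, ha0, ha⟩ : ∃ a : ℝ, 0 < a ∧ ∀ β, 0 < β → Real.cosh β = Real.cosh a * Real.cosh 1 →
      ∀ β', 0 < β' → Real.cosh β' = Real.cosh (1 / z * a) * Real.cosh (1 / z * 1) →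
      Real.sinh (t * β') * Real.sinh (1 / z * a) * (Real.sinh ((1 - t) * β) * Real.sinh 1) ≠
        Real.sinh (t * β) * Real.sinh a * (Real.sinh ((1 - t) * β') * Real.sinh (1 / z * 1)) := by
    rcases lt_or_gt_of_ne hz1 with hlt | hgt
    · obtain ⟨a, ha0, ha⟩ := ((eventually_gt_atTop (0 : ℝ)).and
        (eventually_scaled_lt (k := 1 / z) (b := 1 / z * 1) (b' := 1) ht0 ht1
          ((one_lt_div hz).2 hlt) (by positivity) one_pos
          (Real.sinh (1 / z * 1) / Real.sinh 1))).exists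
      -- For `z < 1` the inner mean has the larger parameter; it is the `a` of the growth lemma, so
      -- the outer one is `z * a`.
      refine ⟨z * a, by positivity, fun β hβ hc β' hβ' hc' => ne_of_gt ?_⟩
      have e1 : a / (1 / z) = z * a := by field_simp
      have e2 : 1 / z * (z * a) = a := by field_simp
      rw [e2] at hc' ⊢
      rw [e1] at ha
      have := mul_lt_mul_of_pos_right (ha β' hβ' hc' β hβ hc) hs
      calc _ = Real.sinh (1 / z * 1) / Real.sinh 1 * (Real.sinh (t * β) * Real.sinh (z * a)) *
            Real.sinh ((1 - t) * β') * Real.sinh 1 := by field_simp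
        _ < _ := this
        _ = _ := by ring
    · obtain ⟨a, ha0, ha⟩ := ((eventually_gt_atTop (0 : ℝ)).and
        (eventually_scaled_lt (k := z) (b := 1) (b' := 1 / z * 1) ht0 ht1 hgt one_pos
          (by positivity) (Real.sinh 1 / Real.sinh (1 / z * 1)))).exists
      refine ⟨a, ha0, fun β hβ hc β' hβ' hc' => ne_of_lt ?_⟩
      have e1 : a / z = 1 / z * a := by field_simp
      rw [e1] at ha
      have := mul_lt_mul_of_pos_right (ha β hβ hc β' hβ' hc') hsz
      calc _ = Real.sinh 1 / Real.sinh (1 / z * 1) *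
            (Real.sinh (t * β') * Real.sinh (1 / z * a)) * Real.sinh ((1 - t) * β) *
              Real.sinh (1 / z * 1) := by field_simp
        _ < _ := this
        _ = _ := by ring
  obtain ⟨β, hβ, hc⟩ := exists_cosh_eq_cosh_mul_cosh ha0 1
  have haz : 0 < 1 / z * a := by positivity
  obtain ⟨β', hβ', hc'⟩ := exists_cosh_eq_cosh_mul_cosh haz (1 / z * 1)
  have hne := ha β hβ hc β' hβ' hc'
  obtain ⟨c', hK⟩ := kuboAndo_expX_expZ t (b := 1 / z * 1) (by positivity) hβ'.ne' hc'
  have h₁ := expZ_posDef a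
  have h₂ := expX_posDef 1
  have hM := kuboAndo_posDef t (mpow_posDef h₂ (1 / z)) (mpow_posDef h₁ (1 / z))
  have hG : (meanGHatFun t z (expZ a) (expX 1)).PosDef := mpow_posDef hM z
  have hB : ∀ p, (mpow (mpow (expX 1) (1 / z)) p).det = 1 :=
    det_mpow (mpow_posDef h₂ _) (det_mpow h₂ (expX_det 1) _)
  have hsβ : 0 < Real.sinh β' := Real.sinh_pos_iff.2 hβ'
  have hGf := meanGHatFun.eq_1 t z (expZ a) (expX 1)
  rw [mpow_expX one_ne_zero, mpow_expZ ha0.ne', hK, mpow] at hGf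
  refine ⟨expZ a, expX 1, h₁, h₂, not_le_kuboAndo_of_eq_cfc
    one_ne_zero hβ hc hGf hG (det_mpow hM ?_ z) ?_⟩
  · rw [kuboAndo, Matrix.det_mul, Matrix.det_mul, hB, det_mpow (sandwich_posDef
      (mpow_posDef (mpow_posDef h₂ _) _) (mpow_posDef h₁ _)) (by
        rw [Matrix.det_mul, Matrix.det_mul, hB, det_mpow h₁ (expZ_det a), one_mul, one_mul]),
      one_mul, one_mul]
  · intro heq
    refine hne (mul_left_cancel₀ (inv_ne_zero hsβ.ne') ?_)
    linear_combination heq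

theorem exists_not_meanGHatTopFun_le_kuboAndo (ht0 : 0 < t) (ht1 : t < 1) :
    ∃ A₁ A₂ : Op 2, A₁.PosDef ∧ A₂.PosDef ∧ ¬ meanGHatTopFun t A₁ A₂ ≤ kuboAndo t A₂ A₁ := by
  have ht : 0 < 1 - t := sub_pos.2 ht1
  -- The exponent has vector `(t a, 1 - t)`, whose slope is only linear in `a`.
  obtain ⟨a, ha0, ha⟩ := ((eventually_gt_atTop (0 : ℝ)).and
    (eventually_linear_lt ht0 ht1 one_pos (t * Real.sinh 1 / (1 - t)))).exists
  obtain ⟨β, hβ, hcosh⟩ := exists_cosh_eq_cosh_mul_cosh ha0 1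
  have hlt := mul_lt_mul_of_pos_right (ha β hβ hcosh) ht
  have hlog : t • mlog (expZ a) + (1 - t) • mlog (expX 1) = bloch 0 (t * a) (1 - t) := by
    rw [mlog_expZ ha0.ne', mlog_expX one_ne_zero]
    ext i j
    fin_cases i <;> fin_cases j <;> simp [bloch]
  have hG : meanGHatTopFun t (expZ a) (expX 1) = cfc Real.exp (bloch 0 (t * a) (1 - t)) := by
    rw [meanGHatTopFun, hlog, mexp]
  set r := Real.sqrt ((t * a) ^ 2 + (1 - t) ^ 2)
  have hr0 : 0 < r := Real.sqrt_pos.2 (by positivity)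
  have hr2 : r ^ 2 = (t * a) ^ 2 + (1 - t) ^ 2 := Real.sq_sqrt (by positivity)
  refine ⟨expZ a, expX 1, expZ_posDef a, expX_posDef 1, not_le_kuboAndo_of_eq_cfc
    one_ne_zero hβ hcosh hG ?_ ?_ (ne_of_lt ?_)⟩
  · rw [hG]
    exact cfc_posDef (bloch_isHermitian _ _ _) fun x _ => Real.exp_pos x
  · rw [hG, cfc_bloch _ hr2 hr0.ne', zero_add, zero_sub, bloch_det, ← Complex.ofReal_one]
    congr 1
    have h1 : Real.exp r * Real.exp (-r) = 1 := by rw [← Real.exp_add, add_neg_cancel, Real.exp_zero]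
    field_simp
    linear_combination 4 * r ^ 2 * h1 + (Real.exp r - Real.exp (-r)) ^ 2 * hr2
  · calc _ = t * Real.sinh 1 / (1 - t) * a * Real.sinh ((1 - t) * β) * (1 - t) := by field_simp
      _ < _ := hlt

end Witnesses

end OperatorMeans

theorem mainTheorem10 (t : ℝ) (ht0 : 0 < t) (ht1 : t < 1) :
    -- none of the means is asymptotically individually AM bounded
    ((∀ z : ℝ, 0 < z → ¬ (OperatorMeans.meanG t z).AsympIndivAMBounded) ∧
      (∀ z : ℝ, 0 < z → ¬ (OperatorMeans.meanGTilde t z).AsympIndivAMBounded) ∧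
      (∀ z : ℝ, 0 < z → z ≠ 1 → ¬ (OperatorMeans.meanGHat t z).AsympIndivAMBounded) ∧
      ¬ (OperatorMeans.meanGHatTop t).AsympIndivAMBounded) ∧
    -- 2×2 positive definite pairs at which the Kubo-Ando upper bound fails
    ((∀ z : ℝ, 0 < z → ∃ A₁ A₂ : OperatorMeans.Op 2, A₁.PosDef ∧ A₂.PosDef ∧
        ¬ OperatorMeans.meanGFun t z A₁ A₂ ≤ OperatorMeans.kuboAndo t A₂ A₁) ∧
      (∀ z : ℝ, 0 < z → ∃ A₁ A₂ : OperatorMeans.Op 2, A₁.PosDef ∧ A₂.PosDef ∧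
        ¬ OperatorMeans.meanGTildeFun t z A₁ A₂ ≤ OperatorMeans.kuboAndo t A₂ A₁) ∧
      (∀ z : ℝ, 1 < z → ∃ A₁ A₂ : OperatorMeans.Op 2, A₁.PosDef ∧ A₂.PosDef ∧
        ¬ OperatorMeans.meanGHatFun t z A₁ A₂ ≤ OperatorMeans.kuboAndo t A₂ A₁) ∧
      ∃ A₁ A₂ : OperatorMeans.Op 2, A₁.PosDef ∧ A₂.PosDef ∧
        ¬ OperatorMeans.meanGHatTopFun t A₁ A₂ ≤ OperatorMeans.kuboAndo t A₂ A₁) := by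
  refine ⟨⟨fun z hz h => ?_, fun z hz h => ?_, fun z hz hz1 h => ?_, fun h => ?_⟩,
    fun z hz => OperatorMeans.exists_not_meanGFun_le_kuboAndo ht0 ht1 hz,
    fun z hz => OperatorMeans.exists_not_meanGTildeFun_le_kuboAndo ht0 ht1 hz,
    fun z hz => OperatorMeans.exists_not_meanGHatFun_le_kuboAndo ht0 ht1 (by linarith) hz.ne',
    OperatorMeans.exists_not_meanGHatTopFun_le_kuboAndo ht0 ht1⟩
  · obtain ⟨A₁, A₂, h₁, h₂, hn⟩ := OperatorMeans.exists_not_meanGFun_le_kuboAndo ht0 ht1 hz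
    exact hn (OperatorMeans.le_kuboAndo_of_asympIndivAMBounded ht0 ht1 h two_pos h₁ h₂
      fun c hc => OperatorMeans.meanGFun_smul h₁ h₂ hz hc)
  · obtain ⟨A₁, A₂, h₁, h₂, hn⟩ := OperatorMeans.exists_not_meanGTildeFun_le_kuboAndo ht0 ht1 hz
    exact hn (OperatorMeans.le_kuboAndo_of_asympIndivAMBounded ht0 ht1 h two_pos h₁ h₂
      fun c hc => OperatorMeans.meanGTildeFun_smul h₁ h₂ hz hc)
  · obtain ⟨A₁, A₂, h₁, h₂, hn⟩ := OperatorMeans.exists_not_meanGHatFun_le_kuboAndo ht0 ht1 hz hz1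
    exact hn (OperatorMeans.le_kuboAndo_of_asympIndivAMBounded ht0 ht1 h two_pos h₁ h₂
      fun c hc => OperatorMeans.meanGHatFun_smul h₁ h₂ hz hc)
  · obtain ⟨A₁, A₂, h₁, h₂, hn⟩ := OperatorMeans.exists_not_meanGHatTopFun_le_kuboAndo ht0 ht1
    exact hn (OperatorMeans.le_kuboAndo_of_asympIndivAMBounded ht0 ht1 h two_pos h₁ h₂
      fun c hc => OperatorMeans.meanGHatTopFun_smul h₁ hc)
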